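/- Let $n\ge 1$ and let $\mathcal S_1,\dots,\mathcal S_n$ be finite sets of transient states of a Markov jump process with one further, absorbing, state $\star$. For $1\le k\le n$ let $A_k$ be the square matrix of transition rates inside $\mathcal S_k$ (nonnegative off-diagonal entries), for $k<n$ let $D_k\ge 0$ be the matrix of transition rates from $\mathcal S_k$ to $\mathcal S_{k+1}$, and let $D_n\ge 0$ be a matrix such that $D_n\mathbf 1$ is the vector of transition rates from $\mathcal S_n$ to $\star$; there are no other transitions, so $D_k\mathbf 1=-A_k\mathbf 1$ for all $k$. Let $\boldsymbol\alpha$ be a probability vector on $\mathcal S_1$, and let the random vector $\boldsymbol Y=(Y_1,\dots,Y_n)$ have the multivariate phase-type law with density $$f(y_1,\dots,y_n)=\boldsymbol\alpha e^{A_1y_1}D_1e^{A_2y_2}D_2\cdots e^{A_ny_n}D_n\mathbf 1,\qquad y_1,\dots,y_n\ge 0 .$$ Let $p_n$ be the largest dimension of the matrices $A_1,\dots,A_n$, let $-\sigma_n$ be the largest of their dominating eigenvalues (the dominating eigenvalue of a matrix is its eigenvalue with the largest real part; it is real and negative for each $A_k$), and let $\nu_n=\max_{1\le k\le n}\max_{i}(-A_k\mathbf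 1)_i$. Fix $\nu\ge\nu_n$, an integer $p\ge p_n$ and $0<\sigma\le\sigma_n$. Let $\boldsymbol L$ be a random vector with $n$ i.i.d. $\mathrm{Exp}(\nu)$ entries (rate $\nu$) and $\boldsymbol H$ a random vector with $n$ i.i.d. $\mathrm{Erlang}(p,\sigma)$ entries ($p$ stages, each of rate $\sigma$). Then $$\boldsymbol L\le_{\mathrm{st}}\boldsymbol Y\le_{\mathrm{st}}\boldsymbol H$$ in the multivariate usual stochastic order: for every increasing set $\Gamma\subseteq\mathbb R^n$ (that is, $x\in\Gamma$ and $y\ge 0$ componentwise imply $x+y\in\Gamma$), $$\mathbb P(\boldsymbol L\in\Gamma)\le\mathbb P(\boldsymbol Y\in\Gamma)\le\mathbb P(\boldsymbol H\in\Gamma).$$ -/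

import Mathlib

open MeasureTheory ProbabilityTheory Filter Topology
open scoped Matrix

noncomputable section

namespace MultPH

/-- The dominating eigenvalue of a real square matrix: the largest real part of its complex
eigenvalues (for a sub-generator matrix, the eigenvalue with the largest real part is real). -/
def dominatingEigenvalue {ι : Type*} [Fintype ι] [DecidableEq ι] (A : Matrix ι ι ℝ) : ℝ :=
  sSup (Complex.re '' spectrum ℂ (A.map Complex.ofReal))

variable {n : ℕ} {S : Fin (n + 1) → Type*} [∀ k, Fintype (S k)] [∀ k, DecidableEq (S k)]

/-- `(α, A, D)` is a representation of a multivariate phase-type law with `n` components. The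
transient states are `S 0, …, S (n - 1)` (the index `k : Fin n` being read in `Fin (n + 1)` through
`k.castSucc`), `A k` holds the transition rates inside the `k`-th block and `D k` those from that
block to the next one. The last index set `S n` only labels the columns of the last matrix `D`,
whose row sums are the transition rates from the last block to the absorbing state. -/
structure IsRepresentation (α : S 0 → ℝ)
    (A : ∀ k : Fin n, Matrix (S k.castSucc) (S k.castSucc) ℝ)
    (D : ∀ k : Fin n, Matrix (S k.castSucc) (S k.succ) ℝ) : Prop where
  alpha_nonneg : ∀ i, 0 ≤ α i
  alpha_sum : ∑ i, α i = 1
  offDiag_nonneg : ∀ k i j, i ≠ j → 0 ≤ A k i j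
  D_nonneg : ∀ k i j, 0 ≤ D k i j
  /-- the rows of the generator sum to zero -/
  row_sum : ∀ k, A k *ᵥ 1 + D k *ᵥ 1 = 0
  /-- every state `i` of every block is transient: the expected total time spent in `i` when
  starting from `i` is finite -/
  transient : ∀ k i, IntegrableOn (fun t : ℝ => NormedSpace.exp (t • A k) i i) (Set.Ioi 0)

/-- The row vector `α e^{A₁ y₁} D₁ ⋯ e^{A_k y_k} D_k`. -/
def rowVec (α : S 0 → ℝ) (A : ∀ k : Fin n, Matrix (S k.castSucc) (S k.castSucc) ℝ)
    (D : ∀ k : Fin n, Matrix (S k.castSucc) (S k.succ) ℝ) (y : Fin n → ℝ) (k : Fin (n + 1)) :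
    S k → ℝ :=
  Fin.induction (motive := fun k => S k → ℝ) α
    (fun k v => v ᵥ* NormedSpace.exp (y k • A k) ᵥ* D k) k

open Classical in
/-- The joint density `α e^{A₁ y₁} D₁ ⋯ e^{A_n y_n} D_n 1` on the nonnegative orthant
(and `0` elsewhere). -/
def density (α : S 0 → ℝ) (A : ∀ k : Fin n, Matrix (S k.castSucc) (S k.castSucc) ℝ)
    (D : ∀ k : Fin n, Matrix (S k.castSucc) (S k.succ) ℝ) (y : Fin n → ℝ) : ℝ :=
  if ∀ k, 0 ≤ y k then rowVec α A D y (Fin.last n) ⬝ᵥ 1 else 0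

/-- The multivariate phase-type law with representation `(α, A, D)`. -/
def law (α : S 0 → ℝ) (A : ∀ k : Fin n, Matrix (S k.castSucc) (S k.castSucc) ℝ)
    (D : ∀ k : Fin n, Matrix (S k.castSucc) (S k.succ) ℝ) : Measure (Fin n → ℝ) :=
  volume.withDensity fun y => ENNReal.ofReal (density α A D y)

/-- The largest dimension of the matrices `A₁, …, A_n`. -/
def maxDim (S : Fin (n + 1) → Type*) [∀ k, Fintype (S k)] : ℕ :=
  Finset.univ.sup fun k : Fin n => Fintype.card (S k.castSucc)

/-- The largest of the dominating eigenvalues of `A₁, …, A_n`. -/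
def maxDominatingEigenvalue (A : ∀ k : Fin n, Matrix (S k.castSucc) (S k.castSucc) ℝ) : ℝ :=
  ⨆ k, dominatingEigenvalue (A k)

/-- The largest entry of the exit rate vectors `-A_k 1`. -/
def maxExitRate (A : ∀ k : Fin n, Matrix (S k.castSucc) (S k.castSucc) ℝ) : ℝ :=
  ⨆ ki : (k : Fin n) × S k.castSucc, (-(A ki.1 *ᵥ 1)) ki.2

/-- The Erlang law with `p` stages of rate `σ`. -/
def erlangMeasure (p : ℕ) (σ : ℝ) : Measure ℝ := gammaMeasure p σ

/-- The multivariate usual stochastic order between laws on `ℝⁿ`: comparison on all increasing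
sets. (Increasing sets are Lebesgue measurable up to null sets; for laws with a density the
inequality compares the integrals of the densities, see `stochLE_withDensity_iff`.) -/
def StochLE (μ ν : Measure (Fin n → ℝ)) : Prop :=
  ∀ Γ : Set (Fin n → ℝ), IsUpperSet Γ → μ Γ ≤ ν Γ

theorem stochLE_withDensity_iff (f g : (Fin n → ℝ) → ENNReal) :
    StochLE (volume.withDensity f) (volume.withDensity g) ↔
      ∀ Γ : Set (Fin n → ℝ), IsUpperSet Γ → ∫⁻ x in Γ, f x ≤ ∫⁻ x in Γ, g x := by
  simp only [StochLE, withDensity_apply']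

end MultPH

end

/-! ### Metzler matrices: positive semigroups, minimum principle, Green function -/

namespace Metzler

variable {ι : Type*} [Fintype ι] [DecidableEq ι]

/-! Each component is compared with a one-dimensional law, uniformly in the vector `v` of weights
with which its block is entered. Its survival function is `v e^{tA} 1`. Since this uniformity makes
the comparison insensitive to the dependence between components, the joint order follows by
conditioning on the first component: the remaining ones form the same model with an unnormalised
initial vector (`le_lintegral_density`, `lintegral_density_le`).

The exponential lower bound is immediate: `A 1 ≥ -ν 1` and `e^{tA} ≥ 0` give `e^{tA} 1 ≥ e^{-νt} 1`.

The Erlang upper bound is the core. Let `h > 0` satisfy `A h ≤ -σ h`, and let `G = -A⁻¹ ≥ 0` be the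
Green matrix. Then `e^{tA} 1 = G e^{tA} (-A 1)` with `-A 1 ≥ 0` and `G (-A 1) = 1`, so it suffices
to show `(G e^{tA}) i j ≤ G i j * erlangTail m σ t` for `m` states (`green_mul_exp_le`). On the
diagonal the decay is purely exponential, because a column of `G`, divided by `h`, is largest on the
diagonal. Off the diagonal, split at the last visit to `i`: the time spent returning to `i` costs
one exponential stage, and the path afterwards lives on `m - 1` states, where induction applies.

A suitable `h` comes from the resolvent `(s - A)⁻¹ 1`, which stays positive as `s` decreases to any
level above the dominating eigenvalue (`exists_pos_mulVec_lt`). The eigenvalue itself is reached by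
a limit in `σ`. -/

theorem le_of_hasDerivAt_nonpos {f f' : ℝ → ℝ} {t : ℝ} (ht : 0 ≤ t)
    (hf : ∀ u, HasDerivAt f (f' u) u) (hf' : ∀ u, 0 ≤ u → u ≤ t → f' u ≤ 0) : f t ≤ f 0 := by
  refine antitoneOn_of_deriv_nonpos (convex_Icc 0 t) (fun u _ => (hf u).continuousAt.continuousWithinAt)
    (fun u _ => (hf u).differentiableAt.differentiableWithinAt) (fun u hu => ?_)
    (Set.left_mem_Icc.2 ht) (Set.right_mem_Icc.2 ht) ht
  rw [interior_Icc] at hu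
  rw [(hf u).deriv]
  exact hf' u hu.1.le hu.2.le

open scoped Matrix.Norms.Operator in
theorem hasDerivAt_exp_smul (A : Matrix ι ι ℝ) (t : ℝ) (i j : ι) :
    HasDerivAt (fun u : ℝ => NormedSpace.exp (u • A) i j) ((NormedSpace.exp (t • A) * A) i j) t :=
  hasDerivAt_pi.1 (hasDerivAt_pi.1 (hasDerivAt_exp_smul_const A t) i) j

open scoped Matrix.Norms.Operator in
theorem commute_exp_smul {A M : Matrix ι ι ℝ} (h : Commute A M) (t : ℝ) :
    Commute (NormedSpace.exp (t • A)) M :=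
  (h.smul_left t).exp_left

theorem exp_zero_smul (A : Matrix ι ι ℝ) : NormedSpace.exp ((0 : ℝ) • A) = 1 := by
  rw [zero_smul, NormedSpace.exp_zero]

theorem hasDerivAt_dotProduct_exp (A : Matrix ι ι ℝ) (v w : ι → ℝ) (t : ℝ) :
    HasDerivAt (fun u : ℝ => v ⬝ᵥ (NormedSpace.exp (u • A) *ᵥ w))
      (v ⬝ᵥ (NormedSpace.exp (t • A) *ᵥ (A *ᵥ w))) t := by
  rw [Matrix.mulVec_mulVec]
  simp only [dotProduct, Matrix.mulVec]
  exact HasDerivAt.fun_sum fun i _ => (HasDerivAt.fun_sum fun j _ =>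
    (hasDerivAt_exp_smul A t i j).mul_const _).const_mul _

open scoped Matrix.Norms.Operator in
theorem exp_nonneg_of_nonneg {A : Matrix ι ι ℝ} (hA : ∀ i j, 0 ≤ A i j) (i j : ι) :
    0 ≤ NormedSpace.exp A i j := by
  have h := NormedSpace.exp_series_hasSum_exp' (𝕂 := ℝ) A
  have h2 := Pi.hasSum.1 (Pi.hasSum.1 h i) j
  refine h2.nonneg fun n => ?_
  have hn : ∀ n, ∀ i j, 0 ≤ (A ^ n) i j := by
    intro n
    induction n with
    | zero => intro i j; rw [pow_zero, Matrix.one_apply]; split_ifs <;> norm_num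
    | succ n ih =>
      intro i j
      rw [pow_succ, Matrix.mul_apply]
      exact Finset.sum_nonneg fun k _ => mul_nonneg (ih _ _) (hA _ _)
  exact mul_nonneg (by positivity) (hn n i j)

/-- The exponential of a matrix with nonnegative off-diagonal entries is nonnegative. -/
theorem exp_nonneg {A : Matrix ι ι ℝ} (hA : ∀ i j, i ≠ j → 0 ≤ A i j) {t : ℝ} (ht : 0 ≤ t)
    (i j : ι) : 0 ≤ NormedSpace.exp (t • A) i j := by
  -- Shifting by a large scalar matrix makes every entry nonnegative and changes the exponential
  -- only by a positive scalar factor.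
  set c : ℝ := ∑ k, |A k k|
  have hc : ∀ k, 0 ≤ A k k + c := fun k => by
    have h1 : |A k k| ≤ c :=
      Finset.single_le_sum (f := fun k => |A k k|) (fun k _ => abs_nonneg _) (Finset.mem_univ k)
    linarith [neg_abs_le (A k k)]
  have hsplit : t • A = t • (A + Matrix.diagonal fun _ => c) +
      Matrix.diagonal fun _ => -(t * c) := by
    ext k l
    by_cases h : k = l
    · subst h; simp
    · simp [h]
  have hcomm : Commute (t • (A + Matrix.diagonal fun _ => c))
      (Matrix.diagonal fun _ => -(t * c)) := by
    have : (Matrix.diagonal fun _ : ι => -(t * c)) = (-(t * c)) • (1 : Matrix ι ι ℝ) := by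
      rw [Matrix.smul_one_eq_diagonal]
    rw [this]
    exact (Commute.one_right _).smul_right _
  rw [hsplit, Matrix.exp_add_of_commute _ _ hcomm, Matrix.exp_diagonal, Matrix.mul_diagonal]
  refine mul_nonneg (exp_nonneg_of_nonneg (fun k l => ?_) i j) ?_
  · by_cases h : k = l
    · subst h; simpa using mul_nonneg ht (hc k)
    · simpa [h] using mul_nonneg ht (hA k l h)
  · rw [Pi.coe_exp, ← Real.exp_eq_exp_ℝ]
    exact (Real.exp_pos _).le

omit [DecidableEq ι] in
theorem mulVec_mono {E : Matrix ι ι ℝ} (hE : ∀ i j, 0 ≤ E i j) {v w : ι → ℝ}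
    (h : ∀ i, v i ≤ w i) (i : ι) : (E *ᵥ v) i ≤ (E *ᵥ w) i :=
  Finset.sum_le_sum fun j _ => mul_le_mul_of_nonneg_left (h j) (hE i j)

/-- A minimum principle. -/
theorem nonneg_of_mulVec_nonpos {A : Matrix ι ι ℝ} (hoff : ∀ i j, i ≠ j → 0 ≤ A i j)
    {h : ι → ℝ} (hpos : ∀ i, 0 < h i) (hA : ∀ i, (A *ᵥ h) i < 0) {x : ι → ℝ}
    (hx : ∀ i, 0 ≤ x i ∨ (A *ᵥ x) i ≤ 0) (i : ι) : 0 ≤ x i := by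
  -- At a minimiser `k` of `x / h` with quotient `q < 0`, one has `x ≥ q h` with equality at `k`.
  -- Hence `(A x) k ≥ q (A h) k > 0`, against the hypothesis at `k`.
  obtain ⟨k, -, hk⟩ := Finset.exists_min_image Finset.univ (fun i => x i / h i) ⟨i, Finset.mem_univ i⟩
  have hk' : ∀ j, x k / h k * h j ≤ x j := fun j =>
    (le_div_iff₀ (hpos j)).1 (hk j (Finset.mem_univ j))
  by_cases hneg : 0 ≤ x k
  · exact le_trans (mul_nonneg (div_nonneg hneg (hpos k).le) (hpos i).le) (hk' i)
  · exfalso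
    have h1 := (hx k).resolve_left hneg
    have hq : x k / h k < 0 := div_neg_of_neg_of_pos (not_le.1 hneg) (hpos k)
    have h2 : x k / h k * (A *ᵥ h) k ≤ (A *ᵥ x) k := by
      simp only [Matrix.mulVec, dotProduct, Finset.mul_sum]
      refine Finset.sum_le_sum fun j _ => ?_
      by_cases hj : k = j
      · subst hj
        have := (hpos k).ne'
        apply le_of_eq; field_simp
      · calc x k / h k * (A k j * h j) = A k j * (x k / h k * h j) := by ring
          _ ≤ _ := mul_le_mul_of_nonneg_left (hk' j) (hoff k j hj)
    linarith [mul_pos_of_neg_of_neg hq (hA k)]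

theorem isUnit_det {A : Matrix ι ι ℝ} (hoff : ∀ i j, i ≠ j → 0 ≤ A i j)
    {h : ι → ℝ} (hpos : ∀ i, 0 < h i) (hA : ∀ i, (A *ᵥ h) i < 0) : IsUnit A.det := by
  rw [isUnit_iff_ne_zero]
  intro h0
  obtain ⟨v, hv, hv0⟩ := Matrix.exists_mulVec_eq_zero_iff.2 h0
  apply hv
  funext i
  refine le_antisymm ?_ (nonneg_of_mulVec_nonpos hoff hpos hA (fun j => Or.inr (by simp [hv0])) i)
  have := nonneg_of_mulVec_nonpos hoff hpos hA (x := -v)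
    (fun j => Or.inr (by simp [Matrix.mulVec_neg, hv0])) i
  simpa using this

omit [DecidableEq ι] in
theorem mul_apply_eq_mulVec_col (A G : Matrix ι ι ℝ) (i j : ι) :
    (A *ᵥ fun l => G l j) i = (A * G) i j := rfl

/-- The negative inverse of `A` exists and is nonnegative. -/
theorem exists_green {A : Matrix ι ι ℝ} (hoff : ∀ i j, i ≠ j → 0 ≤ A i j)
    {h : ι → ℝ} (hpos : ∀ i, 0 < h i) (hA : ∀ i, (A *ᵥ h) i < 0) :
    ∃ G : Matrix ι ι ℝ, A * G = -1 ∧ G * A = -1 ∧ ∀ i j, 0 ≤ G i j := by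
  have hu := isUnit_det hoff hpos hA
  have h1 : A * -A⁻¹ = -1 := by rw [mul_neg, Matrix.mul_nonsing_inv _ hu]
  refine ⟨-A⁻¹, h1, by rw [neg_mul, Matrix.nonsing_inv_mul _ hu], fun i j => ?_⟩
  refine nonneg_of_mulVec_nonpos hoff hpos hA (x := fun l => (-A⁻¹) l j) (fun l => Or.inr ?_) i
  rw [mul_apply_eq_mulVec_col, h1, Matrix.neg_apply, Matrix.one_apply]
  split_ifs <;> norm_num

/-- The Green function of a killed chain is largest on the diagonal, up to the harmonic factor. -/
theorem green_le_diag {A G : Matrix ι ι ℝ} (hoff : ∀ i j, i ≠ j → 0 ≤ A i j)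
    {h : ι → ℝ} (hpos : ∀ i, 0 < h i) (hA : ∀ i, (A *ᵥ h) i < 0) (hAG : A * G = -1)
    (hG : ∀ i j, 0 ≤ G i j) (i j : ι) : G i j ≤ h i * (G j j / h j) := by
  -- This vector vanishes at `j`; off `j` column `j` of `A * G` is zero, so `A` maps the vector to
  -- something nonpositive there. This is why the minimum principle offers a choice at each index.
  have key := nonneg_of_mulVec_nonpos hoff hpos hA
    (x := fun l => (G j j / h j) * h l - G l j) (fun l => ?_) i
  · linarith
  · by_cases hl : l = j
    · left; subst hl; have := (hpos l).ne'; field_simp; simp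
    · right
      have : (fun l => (G j j / h j) * h l - G l j) = (G j j / h j) • h - fun l => G l j := rfl
      rw [this, Matrix.mulVec_sub, Matrix.mulVec_smul, Pi.sub_apply, mul_apply_eq_mulVec_col, hAG,
        Matrix.neg_apply, Matrix.one_apply_ne hl, Pi.smul_apply, smul_eq_mul]
      have := mul_nonneg (div_nonneg (hG j j) (hpos j).le) (neg_nonneg.2 (hA l).le)
      linarith

theorem hasDerivAt_exp_mulVec (A : Matrix ι ι ℝ) (w : ι → ℝ) (t : ℝ) (i : ι) :
    HasDerivAt (fun u : ℝ => (NormedSpace.exp (u • A) *ᵥ w) i)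
      ((NormedSpace.exp (t • A) *ᵥ (A *ᵥ w)) i) t := by
  simpa using hasDerivAt_dotProduct_exp A (Pi.single i 1) w t

/-- The function `e^{σu} e^{uA} h` has derivative `e^{σu} e^{uA} (σ h + A h) ≤ 0`. No sign of `h` is
needed, so the reverse bound follows by passing to `-h`. -/
theorem exp_mulVec_le {A : Matrix ι ι ℝ} (hoff : ∀ i j, i ≠ j → 0 ≤ A i j) {σ : ℝ}
    {h : ι → ℝ} (hA : ∀ i, (A *ᵥ h) i ≤ -σ * h i) {t : ℝ} (ht : 0 ≤ t) (i : ι) :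
    (NormedSpace.exp (t • A) *ᵥ h) i ≤ Real.exp (-(σ * t)) * h i := by
  have hd : ∀ u : ℝ, HasDerivAt
      (fun u => Real.exp (σ * u) * (NormedSpace.exp (u • A) *ᵥ h) i)
      (Real.exp (σ * u) * (NormedSpace.exp (u • A) *ᵥ (fun j => σ * h j + (A *ᵥ h) j)) i) u := by
    intro u
    have h1 := ((hasDerivAt_id u).const_mul σ).exp
    have h2 := h1.mul (hasDerivAt_exp_mulVec A h u i)
    refine h2.congr_deriv ?_
    have : (fun j => σ * h j + (A *ᵥ h) j) = σ • h + A *ᵥ h := rfl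
    rw [this, Matrix.mulVec_add, Matrix.mulVec_smul]
    simp; ring
  have := le_of_hasDerivAt_nonpos ht hd (fun u hu _ => by
    refine mul_nonpos_of_nonneg_of_nonpos (Real.exp_pos _).le ?_
    have := mulVec_mono (exp_nonneg hoff hu) (v := fun j => σ * h j + (A *ᵥ h) j) (w := 0)
      (fun j => by have := hA j; simp only [Pi.zero_apply]; linarith) i
    simpa using this)
  simp only [exp_zero_smul, Matrix.one_mulVec, mul_zero, Real.exp_zero, one_mul] at this
  rw [Real.exp_neg, inv_mul_eq_div, le_div_iff₀ (Real.exp_pos _)]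
  linarith

theorem le_exp_mulVec {A : Matrix ι ι ℝ} (hoff : ∀ i j, i ≠ j → 0 ≤ A i j) {σ : ℝ}
    {h : ι → ℝ} (hA : ∀ i, -σ * h i ≤ (A *ᵥ h) i) {t : ℝ} (ht : 0 ≤ t) (i : ι) :
    Real.exp (-(σ * t)) * h i ≤ (NormedSpace.exp (t • A) *ᵥ h) i := by
  have := exp_mulVec_le hoff (σ := σ) (h := -h)
    (fun i => by have := hA i; simp only [Matrix.mulVec_neg, Pi.neg_apply]; linarith) ht i
  simp only [Matrix.mulVec_neg, Pi.neg_apply] at this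
  linarith

theorem exp_mul_green_diag_le {A G : Matrix ι ι ℝ} (hoff : ∀ i j, i ≠ j → 0 ≤ A i j) {σ : ℝ}
    (hσ : 0 < σ) {h : ι → ℝ} (hpos : ∀ i, 0 < h i) (hA : ∀ i, (A *ᵥ h) i ≤ -σ * h i)
    (hAG : A * G = -1) (hG : ∀ i j, 0 ≤ G i j) {t : ℝ} (ht : 0 ≤ t) (i : ι) :
    (NormedSpace.exp (t • A) * G) i i ≤ Real.exp (-(σ * t)) * G i i := by
  have hA' : ∀ i, (A *ᵥ h) i < 0 := fun i => (hA i).trans_lt (by nlinarith [hpos i])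
  have h1 := mulVec_mono (exp_nonneg hoff ht) (v := fun l => G l i) (w := (G i i / h i) • h)
    (fun l => by
      have := green_le_diag hoff hpos hA' hAG hG l i
      simp only [Pi.smul_apply, smul_eq_mul]; linarith) i
  rw [mul_apply_eq_mulVec_col, Matrix.mulVec_smul, Pi.smul_apply, smul_eq_mul] at h1
  refine h1.trans ?_
  have h2 := mul_le_mul_of_nonneg_left (exp_mulVec_le hoff hA ht i)
    (div_nonneg (hG i i) (hpos i).le)
  refine h2.trans (le_of_eq ?_)
  have := (hpos i).ne'
  field_simp

end Metzler

/-! ### The entrywise Erlang bound -/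

namespace Metzler

/-- The tail of the Erlang law with `m` stages of rate `σ`. -/
noncomputable def erlangTail (m : ℕ) (σ t : ℝ) : ℝ :=
  Real.exp (-(σ * t)) * ∑ k ∈ Finset.range m, (σ * t) ^ k / (k.factorial : ℝ)

theorem hasDerivAt_sum_pow_succ_div_factorial (m : ℕ) (σ t u : ℝ) :
    HasDerivAt (fun u => ∑ k ∈ Finset.range m, (σ * (t - u)) ^ (k + 1) / ((k + 1).factorial : ℝ))
      (-σ * ∑ k ∈ Finset.range m, (σ * (t - u)) ^ k / (k.factorial : ℝ)) u := by
  rw [Finset.mul_sum]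
  refine HasDerivAt.fun_sum fun k _ => ?_
  have h1 : HasDerivAt (fun u => σ * (t - u)) (-σ) u := by
    simpa using ((hasDerivAt_id u).const_sub t).const_mul σ
  refine ((h1.pow (k + 1)).div_const _).congr_deriv ?_
  rw [Nat.factorial_succ]
  push_cast
  have : (k.factorial : ℝ) ≠ 0 := by positivity
  have : (k + 1 : ℝ) ≠ 0 := by positivity
  field_simp

/-- The entry on the left is the expected time spent in `j` after time `t`, starting from `i`;
relative to `G i j` it is a survival function. Last-exit decomposition at `i` bounds it by the
convolution of an exponential stage with the same quantity for the chain killed at `i`. The state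
space is quantified inside so that the induction can pass to a subtype. -/
theorem green_mul_exp_le (m : ℕ) {σ : ℝ} (hσ : 0 < σ) :
    ∀ {ι : Type*} [Fintype ι] [DecidableEq ι], Fintype.card ι = m →
    ∀ {A G : Matrix ι ι ℝ} {h : ι → ℝ}, (∀ i j, i ≠ j → 0 ≤ A i j) → (∀ i, 0 < h i) →
    (∀ i, (A *ᵥ h) i ≤ -σ * h i) → A * G = -1 → G * A = -1 → (∀ i j, 0 ≤ G i j) →
    ∀ {t : ℝ}, 0 ≤ t → ∀ i j, (G * NormedSpace.exp (t • A)) i j ≤ G i j * erlangTail m σ t := by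
  induction m with
  | zero =>
    intro ι _ _ hcard A G h _ _ _ _ _ _ t _ i
    exact ((Fintype.card_eq_zero_iff.1 hcard).false i).elim
  | succ m ih =>
    intro ι _ _ hcard A G h hoff hpos hA hAG hGA hG t ht i j
    have hcommG : Commute A G := by rw [Commute, SemiconjBy, hAG, hGA]
    have hdiag : ∀ u, 0 ≤ u → (G * NormedSpace.exp (u • A)) i i ≤ G i i * Real.exp (-(σ * u)) :=
      fun u hu => by
        rw [← (commute_exp_smul hcommG u).eq, mul_comm]
        exact exp_mul_green_diag_le hoff hσ hpos hA hAG hG hu i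
    by_cases hij : j = i
    · subst hij
      refine (hdiag t ht).trans (mul_le_mul_of_nonneg_left ?_ (hG j j))
      rw [erlangTail, Finset.sum_range_succ']
      have : 0 ≤ ∑ k ∈ Finset.range m, (σ * t) ^ (k + 1) / ((k + 1).factorial : ℝ) :=
        Finset.sum_nonneg fun k _ => by positivity
      simp only [pow_zero, Nat.factorial_zero, Nat.cast_one, div_one]
      nlinarith [Real.exp_pos (-(σ * t))]
    -- Remove the state `i`.
    let κ := {l // l ≠ i}
    obtain ⟨j, rfl⟩ : ∃ j' : κ, (j' : ι) = j := ⟨⟨j, hij⟩, rfl⟩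
    clear hij
    set B : Matrix κ κ ℝ := A.submatrix Subtype.val Subtype.val with hB
    set r : κ → ℝ := fun l => A i l with hr
    have hsum : ∀ f : ι → ℝ, ∑ l, f l = f i + ∑ l : κ, f l := fun f => by
      rw [Fintype.sum_eq_add_sum_subtype_ne f i]
    have hBoff : ∀ k l, k ≠ l → 0 ≤ B k l := fun k l hkl =>
      hoff _ _ fun h => hkl (Subtype.ext h)
    -- Deleting a state only drops a nonnegative term, so the restriction of `h` serves the smaller
    -- chain with the same `σ`.
    have hBh : ∀ k, (B *ᵥ fun l : κ => h l) k ≤ -σ * h k := fun k => by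
      refine le_trans ?_ (hA k)
      have h1 : (A *ᵥ h) k = A k i * h i + (B *ᵥ fun l : κ => h l) k := hsum fun l => A k l * h l
      rw [h1]
      have := mul_nonneg (hoff k i k.2) (hpos i).le
      linarith
    obtain ⟨C, hBC, hCB, hC⟩ := exists_green hBoff (fun k => hpos k)
      (fun k => (hBh k).trans_lt (by nlinarith [hpos k]))
    have hcommC : Commute B C := by rw [Commute, SemiconjBy, hBC, hCB]
    have hr0 : ∀ l, 0 ≤ r l := fun l => hoff _ _ l.2.symm
    have hκ : Fintype.card κ = m := by
      have : Fintype.card κ = Fintype.card ι - 1 := Set.card_ne_eq i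
      omega
    set β := r ⬝ᵥ (fun k => C k j) with hβ
    -- The row `i` of `G` off the diagonal.
    have hrow : (fun l : κ => G i l) = (G i i) • (r ᵥ* C) := by
      have h1 : (fun l : κ => G i l) ᵥ* B = -(G i i) • r := by
        funext l
        have h2 : (G * A) i l = G i i * A i l + ((fun l : κ => G i l) ᵥ* B) l :=
          hsum fun k => G i k * A k l
        rw [hGA, Matrix.neg_apply, Matrix.one_apply_ne l.2.symm] at h2
        simp only [hr, Pi.smul_apply, smul_eq_mul]
        linarith
      have h2 : ((fun l : κ => G i l) ᵥ* B) ᵥ* C = -(fun l : κ => G i l) := by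
        rw [Matrix.vecMul_vecMul, hBC, Matrix.vecMul_neg, Matrix.vecMul_one]
      rw [h1, Matrix.smul_vecMul] at h2
      rw [← neg_eq_iff_eq_neg.2 h2, neg_smul, neg_neg]
    -- After the last exit from `i`, through the rates `r`, the path follows `B`. Here `φ`
    -- integrates the resulting rate `ψ` of being in `j`: `φ' = -ψ`, and `φ 0 = β = G i j / G i i`.
    set φ : ℝ → ℝ := fun s => r ⬝ᵥ (NormedSpace.exp (s • B) *ᵥ fun k => C k j) with hφ
    have hφle : ∀ s, 0 ≤ s → φ s ≤ β * erlangTail m σ s := fun s hs => by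
      have : ∀ k, (NormedSpace.exp (s • B) *ᵥ fun k => C k j) k ≤ C k j * erlangTail m σ s :=
        fun k => by
          rw [mul_apply_eq_mulVec_col, (commute_exp_smul hcommC s).eq]
          exact ih hκ hBoff (fun k => hpos k) hBh hBC hCB hC hs k j
      calc φ s ≤ ∑ k, r k * (C k j * erlangTail m σ s) :=
            Finset.sum_le_sum fun k _ => mul_le_mul_of_nonneg_left (this k) (hr0 k)
        _ = β * erlangTail m σ s := by
            rw [hβ, dotProduct, Finset.sum_mul]; exact Finset.sum_congr rfl fun k _ => by ring
    set ψ : ℝ → ℝ := fun s => r ⬝ᵥ (NormedSpace.exp (s • B) *ᵥ Pi.single j 1) with hψ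
    have hψ0 : ∀ s, 0 ≤ s → 0 ≤ ψ s := fun s hs => by
      refine Finset.sum_nonneg fun k _ => mul_nonneg (hr0 k) ?_
      simpa using exp_nonneg hBoff hs k j
    have hφd : ∀ s, HasDerivAt φ (-ψ s) s := fun s => by
      refine (hasDerivAt_dotProduct_exp B r _ s).congr_deriv ?_
      have : (B *ᵥ fun k => C k j) = -Pi.single j 1 := by
        funext k
        rw [mul_apply_eq_mulVec_col, hBC, Matrix.neg_apply, Pi.neg_apply, Matrix.one_apply,
          Pi.single_apply]
      rw [this, Matrix.mulVec_neg, dotProduct_neg]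
    set ρ : ℝ → ι → ℝ := fun u l => (G * NormedSpace.exp (u • A)) i l with hρ
    have hρd : ∀ u l, HasDerivAt (fun u => ρ u l) ((ρ u ᵥ* A) l) u := fun u l => by
      have h1 : HasDerivAt (fun u => ∑ k, G i k * NormedSpace.exp (u • A) k l)
          (∑ k, G i k * (NormedSpace.exp (u • A) * A) k l) u :=
        HasDerivAt.fun_sum fun k _ => (hasDerivAt_exp_smul A u k l).const_mul _
      refine h1.congr_deriv ?_
      change (G * (NormedSpace.exp (u • A) * A)) i l = ((G * NormedSpace.exp (u • A)) * A) i l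
      rw [mul_assoc]
    -- Duhamel interpolation: follow `A` up to time `u`, then `B` up to `t`. The two generators
    -- differ on `κ` only by the flow out of `i`, whence `Ψ' u = ρ u i * ψ (t - u)`.
    set Ψ : ℝ → ℝ := fun u => ∑ l : κ, ρ u l * NormedSpace.exp ((t - u) • B) l j with hΨ
    have hΨd : ∀ u, HasDerivAt Ψ (ρ u i * ψ (t - u)) u := fun u => by
      have h1 : ∀ l, HasDerivAt (fun u => NormedSpace.exp ((t - u) • B) l j)
          (-(B * NormedSpace.exp ((t - u) • B)) l j) u := fun l => by
        have h2 := (hasDerivAt_exp_smul B (t - u) l j).comp u ((hasDerivAt_id u).const_sub t)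
        refine h2.congr_deriv ?_
        rw [(commute_exp_smul (Commute.refl B) (t - u)).eq]; simp
      refine (HasDerivAt.fun_sum fun (l : κ) _ => (hρd u l).mul (h1 l)).congr_deriv ?_
      have h3 : ∀ l : κ, (ρ u ᵥ* A) l = ρ u i * r l + ((fun k : κ => ρ u k) ᵥ* B) l := fun l =>
        hsum fun k => ρ u k * A k l
      have h4 : ∑ l : κ, ρ u l * (B * NormedSpace.exp ((t - u) • B)) l j =
          ∑ l, ((fun k : κ => ρ u k) ᵥ* B) l * NormedSpace.exp ((t - u) • B) l j := by
        change (fun k : κ => ρ u k) ⬝ᵥ (B *ᵥ fun l => NormedSpace.exp ((t - u) • B) l j) =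
          ((fun k : κ => ρ u k) ᵥ* B) ⬝ᵥ fun l => NormedSpace.exp ((t - u) • B) l j
        rw [Matrix.dotProduct_mulVec]
      rw [Finset.sum_add_distrib]
      simp only [mul_neg, Finset.sum_neg_distrib, h4, h3, add_mul, Finset.sum_add_distrib]
      simp only [hψ, dotProduct, Matrix.mulVec_single_one, Matrix.col_apply, Finset.mul_sum]
      ring_nf
    have hΨ0 : Ψ 0 = G i i * φ t := by
      have h1 : ∀ l : κ, ρ 0 l = G i i * (r ᵥ* C) l := fun l => by
        simp only [hρ, exp_zero_smul, mul_one]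
        exact congrFun hrow l
      simp only [hΨ, h1, sub_zero]
      have h2 : (fun k => C k j) = C *ᵥ Pi.single j 1 := by
        funext k; simp
      simp only [hφ]
      rw [h2, Matrix.mulVec_mulVec, (commute_exp_smul hcommC t).eq, ← Matrix.mulVec_mulVec,
        Matrix.dotProduct_mulVec]
      simp [dotProduct, Finset.mul_sum, mul_assoc]
    have hΨt : Ψ t = (G * NormedSpace.exp (t • A)) i j := by
      simp only [hΨ, sub_self, exp_zero_smul, Matrix.one_apply]
      simp [hρ]
    have hGij : G i j = G i i * β := by
      have := congrFun hrow j
      rw [this]; rfl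
    have hφ0 : φ 0 = β := by simp only [hφ, exp_zero_smul, Matrix.one_mulVec]; rfl
    -- `Θ` packs the integral estimate into one monotone function. The middle term comes from
    -- integrating `e^{-σu} ψ (t - u)` by parts; the last is the remaining integral of `σ e^{-σu}`
    -- against the inductive bound for `φ (t - u)`. The diagonal bound and that inductive bound give
    -- `Θ' ≤ 0`, and `Θ t ≤ Θ 0` is the claim with one more stage.
    set Θ : ℝ → ℝ := fun u => Ψ u - G i i * (Real.exp (-(σ * u)) * φ (t - u)) +
      G i i * β * Real.exp (-(σ * t)) *
        ∑ k ∈ Finset.range m, (σ * (t - u)) ^ (k + 1) / ((k + 1).factorial : ℝ) with hΘ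
    have hΘd : ∀ u, HasDerivAt Θ (ρ u i * ψ (t - u) - G i i *
        (-σ * Real.exp (-(σ * u)) * φ (t - u) + Real.exp (-(σ * u)) * ψ (t - u)) +
        G i i * β * Real.exp (-(σ * t)) *
          (-σ * ∑ k ∈ Finset.range m, (σ * (t - u)) ^ k / (k.factorial : ℝ))) u := fun u => by
      have h1 : HasDerivAt (fun u => Real.exp (-(σ * u))) (-σ * Real.exp (-(σ * u))) u := by
        refine (((hasDerivAt_id u).const_mul σ).neg.exp).congr_deriv ?_
        simp; ring
      have h2 : HasDerivAt (fun u => φ (t - u)) (ψ (t - u)) u := by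
        refine ((hφd (t - u)).comp u ((hasDerivAt_id u).const_sub t)).congr_deriv ?_
        simp
      exact ((hΨd u).sub ((h1.mul h2).const_mul _)).add
        ((hasDerivAt_sum_pow_succ_div_factorial m σ t u).const_mul _)
    have hfin := le_of_hasDerivAt_nonpos ht hΘd (fun u hu hut => by
      have h1 := mul_le_mul_of_nonneg_right (hdiag u hu) (hψ0 (t - u) (by linarith))
      have h2 := mul_le_mul_of_nonneg_left (hφle (t - u) (by linarith))
        (mul_nonneg (mul_nonneg (hG i i) hσ.le) (Real.exp_pos (-(σ * u))).le)
      have h3 : Real.exp (-(σ * t)) = Real.exp (-(σ * u)) * Real.exp (-(σ * (t - u))) := by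
        rw [← Real.exp_add]; congr 1; ring
      rw [erlangTail] at h2
      rw [h3]
      change (G * NormedSpace.exp (u • A)) i i * ψ (t - u) - _ + _ ≤ 0
      nlinarith [h1, h2])
    simp only [hΘ, hΨ0, hΨt, sub_self, sub_zero, mul_zero, neg_zero, Real.exp_zero, one_mul,
      hφ0] at hfin
    rw [hGij, erlangTail, Finset.sum_range_succ']
    simp only [ne_eq, Nat.add_eq_zero_iff, one_ne_zero, and_false, not_false_eq_true, zero_pow,
      zero_div, Finset.sum_const_zero, mul_zero, add_zero, zero_add] at hfin
    simp only [pow_zero, Nat.factorial_zero, Nat.cast_one, div_one]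
    linarith

variable {ι : Type*} [Fintype ι] [DecidableEq ι]

theorem exp_mulVec_one_le_of_exists {A : Matrix ι ι ℝ} (hoff : ∀ i j, i ≠ j → 0 ≤ A i j)
    (hrow : ∀ i, (A *ᵥ 1) i ≤ 0) {σ : ℝ} (hσ : 0 < σ) {h : ι → ℝ} (hpos : ∀ i, 0 < h i)
    (hA : ∀ i, (A *ᵥ h) i ≤ -σ * h i) {t : ℝ} (ht : 0 ≤ t) (i : ι) :
    (NormedSpace.exp (t • A) *ᵥ 1) i ≤ erlangTail (Fintype.card ι) σ t := by
  obtain ⟨G, hAG, hGA, hG⟩ := exists_green hoff hpos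
      (fun k => (hA k).trans_lt (by nlinarith [hpos k]))
  have hcomm : Commute A G := by rw [Commute, SemiconjBy, hAG, hGA]
  have h1 : G *ᵥ (-(A *ᵥ 1)) = 1 := by
    rw [Matrix.mulVec_neg, Matrix.mulVec_mulVec, hGA, Matrix.neg_mulVec, neg_neg,
      Matrix.one_mulVec]
  have h2 : (NormedSpace.exp (t • A) *ᵥ 1) i =
      ((G * NormedSpace.exp (t • A)) *ᵥ (-(A *ᵥ 1))) i := by
    rw [← (commute_exp_smul hcomm t).eq, ← Matrix.mulVec_mulVec, h1]
  calc _ = ∑ j, (G * NormedSpace.exp (t • A)) i j * (-(A *ᵥ 1)) j := h2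
    _ ≤ ∑ j, G i j * erlangTail (Fintype.card ι) σ t * (-(A *ᵥ 1)) j :=
        Finset.sum_le_sum fun j _ => mul_le_mul_of_nonneg_right
          (green_mul_exp_le _ hσ rfl hoff hpos hA hAG hGA hG ht i j) (neg_nonneg.2 (hrow j))
    _ = erlangTail (Fintype.card ι) σ t * (G *ᵥ (-(A *ᵥ 1))) i := by
        rw [Matrix.mulVec, dotProduct, Finset.mul_sum]
        exact Finset.sum_congr rfl fun j _ => by ring
    _ = _ := by rw [h1, Pi.one_apply, mul_one]

end Metzler

/-! ### From the dominating eigenvalue to a positive vector -/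

namespace Metzler

variable {ι : Type*} [Fintype ι] [DecidableEq ι]

/-- If `A` has no real eigenvalue in `[a, ∞)`, then `A - a` is strictly subharmonic for some
positive vector. -/
theorem exists_pos_mulVec_lt {A : Matrix ι ι ℝ} (hoff : ∀ i j, i ≠ j → 0 ≤ A i j) {a : ℝ}
    (ha : ∀ s, a ≤ s → (s • (1 : Matrix ι ι ℝ) - A).det ≠ 0) :
    ∃ h : ι → ℝ, (∀ i, 0 < h i) ∧ ∀ i, (A *ᵥ h) i < a * h i := by
  -- This is `(s - A)⁻¹ 1`, written by Cramer's rule so that continuity in `s` is visible.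
  set x : ℝ → ι → ℝ := fun s =>
    ((s • (1 : Matrix ι ι ℝ) - A).det)⁻¹ • ((s • (1 : Matrix ι ι ℝ) - A).adjugate *ᵥ 1) with hx
  have hcontM : Continuous fun s : ℝ => s • (1 : Matrix ι ι ℝ) - A := by fun_prop
  have hcont : ContinuousOn x (Set.Ici a) :=
    (hcontM.matrix_det.continuousOn.inv₀ ha).smul
      (hcontM.matrix_adjugate.matrix_mulVec continuous_const).continuousOn
  have hxeq : ∀ s, a ≤ s → A *ᵥ x s = s • x s - 1 := fun s hs => by
    have h1 : (s • (1 : Matrix ι ι ℝ) - A) *ᵥ x s = 1 := by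
      simp only [hx]
      rw [Matrix.mulVec_smul, Matrix.mulVec_mulVec, Matrix.mul_adjugate, Matrix.smul_mulVec,
        Matrix.one_mulVec, smul_smul, inv_mul_cancel₀ (ha s hs), one_smul]
    rw [Matrix.sub_mulVec, Matrix.smul_mulVec, Matrix.one_mulVec] at h1
    rw [← h1, sub_sub_cancel]
  have hshift : ∀ (s : ℝ) (v : ι → ℝ), (A - s • (1 : Matrix ι ι ℝ)) *ᵥ v = A *ᵥ v - s • v :=
    fun s v => by rw [Matrix.sub_mulVec, Matrix.smul_mulVec, Matrix.one_mulVec]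
  have hpos : ∀ s, a ≤ s → (∀ i, 0 ≤ x s i) → ∀ i, 0 < x s i := fun s hs h0 i => by
    refine lt_of_le_of_ne (h0 i) fun h => ?_
    have h1 := congrFun (hxeq s hs) i
    have h2 : 0 ≤ (A *ᵥ x s) i := Finset.sum_nonneg fun j _ => by
      by_cases hij : i = j
      · subst hij; simp [← h]
      · exact mul_nonneg (hoff i j hij) (h0 j)
    simp only [Pi.sub_apply, Pi.smul_apply, smul_eq_mul, ← h, mul_zero, Pi.one_apply] at h1
    linarith
  have hlt : ∀ s, a ≤ s → ∀ i, (A *ᵥ x s) i < s * x s i := fun s hs i => by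
    rw [hxeq s hs]; simp
  have hnonneg : ∀ s, a ≤ s → (∃ h : ι → ℝ, (∀ i, 0 < h i) ∧ ∀ i, (A *ᵥ h) i < s * h i) →
      ∀ i, 0 ≤ x s i := by
    rintro s hs ⟨h, hh, hAh⟩
    refine nonneg_of_mulVec_nonpos (A := A - s • (1 : Matrix ι ι ℝ)) (h := h)
      (fun i j hij => by simpa [hij] using hoff i j hij) hh (fun i => ?_) (fun i => Or.inr ?_)
    · rw [hshift]; simpa using hAh i
    · rw [hshift]; simpa using (hlt s hs i).le
  -- A continuity argument downwards in `s`: `T` is closed and contains all large `s` (test vector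
  -- `1`). At `s₀ = inf T` the vector `x s₀` is strictly positive and strictly subharmonic, hence
  -- still usable as test vector slightly below `s₀`; so `s₀ > a` is impossible.
  set T : Set ℝ := Set.Ici a ∩ x ⁻¹' (Set.Ici 0) with hT
  have hTcl : IsClosed T := hcont.preimage_isClosed_of_isClosed isClosed_Ici isClosed_Ici
  have hTne : T.Nonempty := by
    refine ⟨max a (∑ i, |(A *ᵥ 1) i| + 1), Set.mem_Ici.2 (le_max_left _ _), hnonneg _ (le_max_left _ _)
      ⟨1, fun _ => one_pos, fun i => ?_⟩⟩
    have h1 : |(A *ᵥ 1) i| ≤ ∑ i, |(A *ᵥ 1) i| :=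
      Finset.single_le_sum (f := fun k => |(A *ᵥ 1) k|) (fun k _ => abs_nonneg _)
        (Finset.mem_univ i)
    have h2 := le_max_right a (∑ i, |(A *ᵥ 1) i| + 1)
    rw [Pi.one_apply, mul_one]
    linarith [le_abs_self ((A *ᵥ 1) i)]
  have hTbdd : BddBelow T := ⟨a, fun s hs => hs.1⟩
  have hmem := hTcl.csInf_mem hTne hTbdd
  set s₀ := sInf T
  have hs₀ : s₀ = a := by
    refine le_antisymm (not_lt.1 fun hlt' => ?_) hmem.1
    have hev : ∀ᶠ s in 𝓝[<] s₀, a < s ∧ ∀ i, (A *ᵥ x s₀) i < s * x s₀ i := by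
      refine eventually_nhdsWithin_of_eventually_nhds
        ((lt_mem_nhds hlt').and (eventually_all.2 fun i => ?_))
      exact (continuous_id.mul continuous_const).tendsto s₀ |>.eventually
        (lt_mem_nhds (hlt s₀ hmem.1 i))
    obtain ⟨s, ⟨hs1, hs2⟩, hs3⟩ := (hev.and self_mem_nhdsWithin).exists
    exact absurd (csInf_le hTbdd ⟨hs1.le, hnonneg s hs1.le ⟨_, hpos s₀ hmem.1 hmem.2, hs2⟩⟩)
      (not_le.2 hs3)
  exact ⟨x s₀, hpos s₀ hmem.1 hmem.2, fun i => hs₀ ▸ hlt s₀ hmem.1 i⟩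

theorem det_ne_zero_of_dominatingEigenvalue_lt {A : Matrix ι ι ℝ} {s : ℝ}
    (hs : MultPH.dominatingEigenvalue A < s) : (s • (1 : Matrix ι ι ℝ) - A).det ≠ 0 := by
  intro h0
  refine absurd (le_csSup ?_ ?_) (not_le.2 hs)
  · exact ((Matrix.finite_spectrum (A.map Complex.ofReal)).image _).bddAbove
  · refine ⟨(s : ℂ), ?_, Complex.ofReal_re s⟩
    rw [spectrum.mem_iff, Matrix.isUnit_iff_isUnit_det, isUnit_iff_ne_zero, not_not]
    have h1 : algebraMap ℂ (Matrix ι ι ℂ) s - A.map Complex.ofReal =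
        Complex.ofRealHom.mapMatrix (s • (1 : Matrix ι ι ℝ) - A) := by
      ext i j
      by_cases hij : i = j
      · subst hij; simp [Matrix.algebraMap_matrix_apply]
      · simp [Matrix.algebraMap_matrix_apply, hij]
    rw [h1, ← RingHom.map_det, h0, map_zero]

theorem exists_pos_of_lt_neg_dominatingEigenvalue {A : Matrix ι ι ℝ}
    (hoff : ∀ i j, i ≠ j → 0 ≤ A i j) {σ : ℝ} (hσ : σ < -MultPH.dominatingEigenvalue A) :
    ∃ h : ι → ℝ, (∀ i, 0 < h i) ∧ ∀ i, (A *ᵥ h) i ≤ -σ * h i := by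
  obtain ⟨h, hh, hA⟩ := exists_pos_mulVec_lt hoff (a := -σ)
    (fun s hs => det_ne_zero_of_dominatingEigenvalue_lt (by linarith))
  exact ⟨h, hh, fun i => (hA i).le⟩

/-- The survival function of a phase-type law of order `m` is bounded by the tail of the Erlang
law with `m` stages whose rate is minus the dominating eigenvalue. -/
theorem exp_mulVec_one_le {A : Matrix ι ι ℝ} (hoff : ∀ i j, i ≠ j → 0 ≤ A i j)
    (hrow : ∀ i, (A *ᵥ 1) i ≤ 0) {σ : ℝ} (hσ : 0 < σ)
    (hσA : σ ≤ -MultPH.dominatingEigenvalue A) {t : ℝ} (ht : 0 ≤ t) (i : ι) :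
    (NormedSpace.exp (t • A) *ᵥ 1) i ≤ erlangTail (Fintype.card ι) σ t := by
  -- At the eigenvalue itself a positive `h` may fail to exist when `A` is reducible, so the bound
  -- is proved for smaller rates and passed to the limit.
  have hlim : Tendsto (fun s => erlangTail (Fintype.card ι) s t) (𝓝[<] σ)
      (𝓝 (erlangTail (Fintype.card ι) σ t)) := by
    refine Continuous.continuousWithinAt (f := fun s => erlangTail (Fintype.card ι) s t) ?_
    unfold erlangTail
    fun_prop
  refine ge_of_tendsto hlim ?_
  filter_upwards [Ioo_mem_nhdsLT hσ] with s hs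
  obtain ⟨h, hh, hA⟩ := exists_pos_of_lt_neg_dominatingEigenvalue hoff (hs.2.trans_le hσA)
  exact exp_mulVec_one_le_of_exists hoff hrow hs.1 hh hA ht i

theorem erlangTail_mono {m p : ℕ} (h : m ≤ p) {σ t : ℝ} (hσ : 0 ≤ σ) (ht : 0 ≤ t) :
    erlangTail m σ t ≤ erlangTail p σ t :=
  mul_le_mul_of_nonneg_left (Finset.sum_le_sum_of_subset_of_nonneg (by simpa using h)
    fun k _ _ => by positivity) (Real.exp_pos _).le

end Metzler

/-! ### Stochastic order on the line; Erlang densities and tails -/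

namespace MultPH

open Metzler

/-- An upper set of the line is empty, everything, or a ray whose endpoint is `μ`-null. -/
theorem measure_upperSet_le_of_tail {μ ν : Measure ℝ} (hμ : μ ≪ volume)
    (htail : ∀ a, μ (Set.Ioi a) ≤ ν (Set.Ioi a)) (huniv : μ Set.univ ≤ ν Set.univ)
    {S : Set ℝ} (hS : IsUpperSet S) : μ S ≤ ν S := by
  rcases S.eq_empty_or_nonempty with rfl | hne
  · simp
  by_cases hb : BddBelow S
  · have h1 : Set.Ioi (sInf S) ⊆ S := fun x hx => by
      obtain ⟨y, hy, hyx⟩ := (csInf_lt_iff hb hne).1 hx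
      exact hS hyx.le hy
    have h2 : S ⊆ Set.Ici (sInf S) := fun x hx => csInf_le hb hx
    calc μ S ≤ μ (Set.Ici (sInf S)) := measure_mono h2
      _ = μ (Set.Ioi (sInf S)) := (measure_congr (hμ.ae_le Ioi_ae_eq_Ici)).symm
      _ ≤ ν (Set.Ioi (sInf S)) := htail _
      _ ≤ ν S := measure_mono h1
  · have : S = Set.univ := Set.eq_univ_of_forall fun x => by
      obtain ⟨y, hy, hyx⟩ := not_bddBelow_iff.1 hb x
      exact hS hyx.le hy
    rw [this]; exact huniv

/-- Layer-cake formula: the superlevel sets of a monotone function are upper sets. -/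
theorem lintegral_le_of_tail {μ ν : Measure ℝ} (hμ : μ ≪ volume)
    (htail : ∀ a, μ (Set.Ioi a) ≤ ν (Set.Ioi a)) (huniv : μ Set.univ ≤ ν Set.univ)
    {g : ℝ → ENNReal} (hg : Monotone g) (hg1 : ∀ x, g x ≤ 1) : ∫⁻ x, g x ∂μ ≤ ∫⁻ x, g x ∂ν := by
  have hne : ∀ x, g x ≠ ⊤ := fun x => ((hg1 x).trans_lt ENNReal.one_lt_top).ne
  have hmono : Monotone fun x => (g x).toReal := fun x y hxy => ENNReal.toReal_mono (hne y) (hg hxy)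
  have h : ∀ m : Measure ℝ, ∫⁻ x, g x ∂m = ∫⁻ t in Set.Ioi 0, m {a | t < (g a).toReal} :=
    fun m => by
      rw [← lintegral_eq_lintegral_meas_lt m (ae_of_all _ fun _ => ENNReal.toReal_nonneg)
        hmono.measurable.aemeasurable]
      simp only [ENNReal.ofReal_toReal (hne _)]
  rw [h, h]
  exact lintegral_mono fun t => measure_upperSet_le_of_tail hμ htail huniv
    fun x y hxy (hx : t < _) => hx.trans_le (hmono hxy)

/-- The measure with density `f` on the half-line. -/
noncomputable def halfLineMeasure (f : ℝ → ℝ) : Measure ℝ :=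
  volume.withDensity fun y => ENNReal.ofReal (if 0 ≤ y then f y else 0)

theorem halfLineMeasure_Ioi_of_nonneg {f F : ℝ → ℝ} (hF : ∀ x, HasDerivAt F (-f x) x)
    (hf : ∀ x, 0 ≤ x → 0 ≤ f x) (hlim : Tendsto F atTop (𝓝 0)) {a : ℝ} (ha : 0 ≤ a) :
    halfLineMeasure f (Set.Ioi a) = ENNReal.ofReal (F a) := by
  have hneg : ∀ x ∈ Set.Ioi a, -f x ≤ 0 := fun x hx => neg_nonpos.2 (hf x (ha.trans hx.le))
  have hint := integrableOn_Ioi_deriv_of_nonpos' (fun x _ => hF x) hneg hlim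
  have hval := integral_Ioi_of_hasDerivAt_of_nonpos' (fun x _ => hF x) hneg hlim
  have hint' : IntegrableOn f (Set.Ioi a) := by simpa using hint.neg
  rw [halfLineMeasure, withDensity_apply _ measurableSet_Ioi]
  rw [integral_neg] at hval
  have h1 : ∫⁻ y in Set.Ioi a, ENNReal.ofReal (if 0 ≤ y then f y else 0) =
      ∫⁻ y in Set.Ioi a, ENNReal.ofReal (f y) :=
    setLIntegral_congr_fun measurableSet_Ioi fun y hy => by
      simp only [if_pos (ha.trans (le_of_lt hy))]
  rw [h1, ← ofReal_integral_eq_lintegral_ofReal hint']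
  · congr 1; linarith
  · exact (ae_restrict_iff' measurableSet_Ioi).2 (ae_of_all _ fun x hx => hf x (ha.trans (le_of_lt hx)))

theorem halfLineMeasure_Iio_zero (f : ℝ → ℝ) : halfLineMeasure f (Set.Iio 0) = 0 := by
  rw [halfLineMeasure, withDensity_apply _ measurableSet_Iio,
    setLIntegral_congr_fun (g := fun _ => 0) measurableSet_Iio, lintegral_zero]
  intro y hy
  simp only [if_neg (not_le.2 (Set.mem_Iio.1 hy)), ENNReal.ofReal_zero]

theorem halfLineMeasure_absolutelyContinuous (f : ℝ → ℝ) : halfLineMeasure f ≪ volume :=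
  withDensity_absolutelyContinuous _ _

theorem halfLineMeasure_of_Ioi_zero_subset (f : ℝ → ℝ) {S : Set ℝ} (hS : Set.Ioi 0 ⊆ S) :
    halfLineMeasure f S = halfLineMeasure f (Set.Ioi 0) := by
  refine le_antisymm ?_ (measure_mono hS)
  have : S ⊆ Set.Iio 0 ∪ Set.Ici 0 := fun x _ => (lt_or_ge x 0).imp id id
  refine (measure_mono this).trans ((measure_union_le _ _).trans ?_)
  rw [halfLineMeasure_Iio_zero, zero_add]
  exact (measure_congr ((halfLineMeasure_absolutelyContinuous f).ae_le Ioi_ae_eq_Ici)).ge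

/-- `F₁` and `F₂` are survival functions, not normalised to be `1` at `0`: total masses may differ,
and their comparison is the case `x = 0` of `hle`. -/
theorem lintegral_halfLineMeasure_le {f₁ f₂ F₁ F₂ : ℝ → ℝ} (hF₁ : ∀ x, HasDerivAt F₁ (-f₁ x) x)
    (hF₂ : ∀ x, HasDerivAt F₂ (-f₂ x) x) (hf₁ : ∀ x, 0 ≤ x → 0 ≤ f₁ x)
    (hf₂ : ∀ x, 0 ≤ x → 0 ≤ f₂ x) (h₁ : Tendsto F₁ atTop (𝓝 0)) (h₂ : Tendsto F₂ atTop (𝓝 0))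
    (hle : ∀ x, 0 ≤ x → F₁ x ≤ F₂ x) {g : ℝ → ENNReal} (hg : Monotone g) (hg1 : ∀ x, g x ≤ 1) :
    ∫⁻ x, g x ∂halfLineMeasure f₁ ≤ ∫⁻ x, g x ∂halfLineMeasure f₂ := by
  have key : ∀ a, 0 ≤ a → halfLineMeasure f₁ (Set.Ioi a) ≤ halfLineMeasure f₂ (Set.Ioi a) :=
    fun a ha => by
      rw [halfLineMeasure_Ioi_of_nonneg hF₁ hf₁ h₁ ha, halfLineMeasure_Ioi_of_nonneg hF₂ hf₂ h₂ ha]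
      exact ENNReal.ofReal_le_ofReal (hle a ha)
  refine lintegral_le_of_tail (halfLineMeasure_absolutelyContinuous _) (fun a => ?_) ?_ hg hg1
  · rcases le_total 0 a with ha | ha
    · exact key a ha
    · rw [halfLineMeasure_of_Ioi_zero_subset _ (Set.Ioi_subset_Ioi ha),
        halfLineMeasure_of_Ioi_zero_subset _ (Set.Ioi_subset_Ioi ha)]
      exact key 0 le_rfl
  · rw [halfLineMeasure_of_Ioi_zero_subset _ (Set.subset_univ _),
      halfLineMeasure_of_Ioi_zero_subset _ (Set.subset_univ _)]
    exact key 0 le_rfl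

/-- The density of the Erlang law with `m + 1` stages. -/
noncomputable def erlangDensity (m : ℕ) (σ t : ℝ) : ℝ :=
  σ * (Real.exp (-(σ * t)) * ((σ * t) ^ m / (m.factorial : ℝ)))

theorem hasDerivAt_erlangTail (m : ℕ) (σ t : ℝ) :
    HasDerivAt (erlangTail (m + 1) σ) (-erlangDensity m σ t) t := by
  have hlin : HasDerivAt (fun u => σ * u) σ t := by simpa using (hasDerivAt_id t).const_mul σ
  have hexp : HasDerivAt (fun u => Real.exp (-(σ * u))) (-σ * Real.exp (-(σ * t))) t :=
    (hlin.neg.exp).congr_deriv (by simp; ring)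
  induction m with
  | zero =>
    have : erlangTail (0 + 1) σ = fun u => Real.exp (-(σ * u)) := by
      funext u; simp [erlangTail]
    rw [this]
    exact hexp.congr_deriv (by simp [erlangDensity])
  | succ m ih =>
    have : erlangTail (m + 1 + 1) σ = fun u => erlangTail (m + 1) σ u +
        Real.exp (-(σ * u)) * ((σ * u) ^ (m + 1) / ((m + 1).factorial : ℝ)) := by
      funext u
      rw [erlangTail, Finset.sum_range_succ, mul_add, erlangTail]
    rw [this]
    refine (ih.add (hexp.mul ((hlin.pow (m + 1)).div_const _))).congr_deriv ?_
    simp only [erlangDensity, Pi.pow_apply, Nat.factorial_succ, Nat.add_sub_cancel]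
    push_cast
    have : (m.factorial : ℝ) ≠ 0 := by positivity
    have : (m + 1 : ℝ) ≠ 0 := by positivity
    field_simp
    ring

theorem tendsto_erlangTail (m : ℕ) {σ : ℝ} (hσ : 0 < σ) :
    Tendsto (erlangTail m σ) atTop (𝓝 0) := by
  have h1 : Tendsto (fun t : ℝ => σ * t) atTop atTop := tendsto_id.const_mul_atTop hσ
  have h2 : ∀ k : ℕ, Tendsto (fun t : ℝ => (σ * t) ^ k * Real.exp (-(σ * t)) / (k.factorial : ℝ))
      atTop (𝓝 0) := fun k => by
    simpa using ((Real.tendsto_pow_mul_exp_neg_atTop_nhds_zero k).comp h1).div_const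
      (k.factorial : ℝ)
  have h3 := tendsto_finsetSum (Finset.range m) fun k _ => h2 k
  simp only [Finset.sum_const_zero] at h3
  refine h3.congr fun t => ?_
  rw [erlangTail, Finset.mul_sum]
  exact Finset.sum_congr rfl fun k _ => by ring

theorem erlangDensity_nonneg (m : ℕ) {σ t : ℝ} (hσ : 0 < σ) (ht : 0 ≤ t) :
    0 ≤ erlangDensity m σ t := by
  unfold erlangDensity; positivity

theorem gammaMeasure_eq_halfLineMeasure (m : ℕ) (σ : ℝ) :
    gammaMeasure ((m + 1 : ℕ) : ℝ) σ = halfLineMeasure (erlangDensity m σ) := by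
  rw [gammaMeasure, halfLineMeasure]
  congr 1
  funext x
  rw [gammaPDF, gammaPDFReal]
  congr 1
  split_ifs with hx
  · rw [Real.rpow_natCast]
    push_cast
    rw [Real.Gamma_nat_eq_factorial, add_sub_cancel_right, Real.rpow_natCast, erlangDensity,
      mul_pow, pow_succ]
    ring
  · rfl

theorem lintegral_halfLineMeasure {f : ℝ → ℝ} (hf : Measurable f) {g : ℝ → ENNReal}
    (hg : Measurable g) :
    ∫⁻ x, g x ∂halfLineMeasure f = ∫⁻ x, ENNReal.ofReal (if 0 ≤ x then f x else 0) * g x := by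
  rw [halfLineMeasure, lintegral_withDensity_eq_lintegral_mul _ _ hg]
  · rfl
  · exact (Measurable.ite measurableSet_Ici hf measurable_const).ennreal_ofReal

theorem continuous_exp_smul {ι : Type*} [Fintype ι] [DecidableEq ι] (A : Matrix ι ι ℝ) :
    Continuous fun t : ℝ => NormedSpace.exp (t • A) :=
  continuous_pi fun i => continuous_pi fun j =>
    continuous_iff_continuousAt.2 fun t => (hasDerivAt_exp_smul A t i j).continuousAt

/-! ### Conditioning on the first component -/

section

variable {n : ℕ} {S : Fin (n + 1) → Type*} [∀ k, Fintype (S k)] [∀ k, DecidableEq (S k)]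

theorem continuous_rowVec (α : S 0 → ℝ) (A : ∀ k : Fin n, Matrix (S k.castSucc) (S k.castSucc) ℝ)
    (D : ∀ k : Fin n, Matrix (S k.castSucc) (S k.succ) ℝ) (k : Fin (n + 1)) :
    Continuous fun y => rowVec α A D y k := by
  induction k using Fin.induction with
  | zero => exact continuous_const
  | succ k ih =>
    change Continuous fun y : Fin n → ℝ =>
      rowVec α A D y k.castSucc ᵥ* NormedSpace.exp (y k • A k) ᵥ* D k
    exact (ih.matrix_vecMul ((continuous_exp_smul (A k)).comp (continuous_apply k))).matrix_vecMul
      continuous_const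

theorem measurable_density (α : S 0 → ℝ)
    (A : ∀ k : Fin n, Matrix (S k.castSucc) (S k.castSucc) ℝ)
    (D : ∀ k : Fin n, Matrix (S k.castSucc) (S k.succ) ℝ) : Measurable (density α A D) := by
  unfold density
  refine Measurable.ite ?_ ?_ measurable_const
  · exact measurableSet_setOfPred.2 (Measurable.forall fun k =>
      measurableSet_setOfPred.1 (measurableSet_le measurable_const (measurable_pi_apply k)))
  · exact ((continuous_rowVec α A D (Fin.last n)).dotProduct continuous_const).measurable

end

/-- The unnormalised law of the state at the end of one component of length `t`, from the initial
vector `v`. -/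
noncomputable def stepVec {ι κ : Type*} [Fintype ι] [DecidableEq ι] (A : Matrix ι ι ℝ)
    (D : Matrix ι κ ℝ) (v : ι → ℝ) (t : ℝ) : κ → ℝ :=
  v ᵥ* NormedSpace.exp (t • A) ᵥ* D

section

variable {n : ℕ} {S : Fin (n + 1 + 1) → Type*} [∀ k, Fintype (S k)] [∀ k, DecidableEq (S k)]

/-- The blocks after the first one. -/
abbrev tailBlocks (S : Fin (n + 1 + 1) → Type*) : Fin (n + 1) → Type _ := fun k => S k.succ

/-- The Markov property at the end of the first component: what follows is the same model on the
shifted blocks, started from `stepVec`. -/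
theorem rowVec_succ (α : S 0 → ℝ)
    (A : ∀ k : Fin (n + 1), Matrix (S k.castSucc) (S k.castSucc) ℝ)
    (D : ∀ k : Fin (n + 1), Matrix (S k.castSucc) (S k.succ) ℝ) (y : Fin (n + 1) → ℝ)
    (k : Fin (n + 1)) :
    rowVec α A D y k.succ = rowVec (S := tailBlocks S)
      (stepVec (A 0) (D 0) α (y 0)) (fun k => A k.succ) (fun k => D k.succ)
      (fun k => y k.succ) k := by
  induction k using Fin.induction with
  | zero => rfl
  | succ k ih =>
    change stepVec (A k.succ) (D k.succ) (rowVec α A D y k.castSucc.succ) (y k.succ) = _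
    rw [ih]
    rfl

theorem density_cons (α : S 0 → ℝ)
    (A : ∀ k : Fin (n + 1), Matrix (S k.castSucc) (S k.castSucc) ℝ)
    (D : ∀ k : Fin (n + 1), Matrix (S k.castSucc) (S k.succ) ℝ) (y₀ : ℝ) (y : Fin n → ℝ) :
    density α A D (Fin.cons y₀ y : Fin (n + 1) → ℝ) = if 0 ≤ y₀ then density (S := tailBlocks S)
      (stepVec (A 0) (D 0) α y₀) (fun k => A k.succ) (fun k => D k.succ) y
      else 0 := by
  have h := rowVec_succ α A D (Fin.cons y₀ y : Fin (n + 1) → ℝ) (Fin.last n)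
  simp only [Fin.cons_zero, Fin.cons_succ] at h
  simp only [density, Fin.forall_fin_succ, Fin.cons_zero, Fin.cons_succ]
  rw [ite_and]
  congr 2
  rw [← h]
  rfl

theorem lintegral_fin_succ_pi (θ : Measure ℝ) [SigmaFinite θ] {f : (Fin (n + 1) → ℝ) → ENNReal}
    (hf : Measurable f) :
    ∫⁻ y, f y ∂(Measure.pi fun _ => θ) =
      ∫⁻ y₀, ∫⁻ y, f (Fin.cons y₀ y : Fin (n + 1) → ℝ) ∂(Measure.pi fun _ => θ) ∂θ := by
  have h := (measurePreserving_piFinSuccAbove (fun _ : Fin (n + 1) => θ) 0).symm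
  rw [← h.lintegral_comp hf, lintegral_prod]
  · simp only [MeasurableEquiv.piFinSuccAbove_symm_apply, Fin.insertNthEquiv, Equiv.coe_fn_mk,
      Fin.insertNth_zero']
  · exact (hf.comp (MeasurableEquiv.measurable _)).aemeasurable

end

theorem measurable_cons {n : ℕ} :
    Measurable fun q : ℝ × (Fin n → ℝ) => (Fin.cons q.1 q.2 : Fin (n + 1) → ℝ) :=
  measurable_pi_iff.2 fun k => by
    refine Fin.cases ?_ (fun k => ?_) k
    · simpa using measurable_fst
    · simpa [Function.comp_def] using (measurable_pi_apply k).comp measurable_snd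

theorem cons_le_cons {n : ℕ} {a b : ℝ} {x y : Fin n → ℝ} (h : a ≤ b) (hxy : x ≤ y) :
    (Fin.cons a x : Fin (n + 1) → ℝ) ≤ Fin.cons b y :=
  Fin.cons_le_cons.2 ⟨h, hxy⟩

/-- The unnormalised density of one component, from the initial vector `v`. -/
noncomputable def stepDensity {ι κ : Type*} [Fintype ι] [DecidableEq ι] [Fintype κ] (A : Matrix ι ι ℝ)
    (D : Matrix ι κ ℝ) (v : ι → ℝ) (t : ℝ) : ℝ :=
  stepVec A D v t ⬝ᵥ 1

theorem continuous_stepDensity {ι κ : Type*} [Fintype ι] [DecidableEq ι] [Fintype κ]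
    (A : Matrix ι ι ℝ) (D : Matrix ι κ ℝ) (v : ι → ℝ) : Continuous (stepDensity A D v) :=
  ((continuous_const.matrix_vecMul (continuous_exp_smul A)).matrix_vecMul
    continuous_const).dotProduct continuous_const

theorem lintegral_cons_density {n : ℕ} {S : Fin (n + 1 + 1) → Type*} [∀ k, Fintype (S k)]
    [∀ k, DecidableEq (S k)] (α : S 0 → ℝ)
    (A : ∀ k : Fin (n + 1), Matrix (S k.castSucc) (S k.castSucc) ℝ)
    (D : ∀ k : Fin (n + 1), Matrix (S k.castSucc) (S k.succ) ℝ)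
    {f : (Fin (n + 1) → ℝ) → ENNReal} (hf : Measurable f) :
    ∫⁻ y, ENNReal.ofReal (density α A D y) * f y = ∫⁻ y₀, if 0 ≤ y₀ then
      ∫⁻ y, ENNReal.ofReal (density (S := tailBlocks S)
      (stepVec (A 0) (D 0) α y₀) (fun k => A k.succ) (fun k => D k.succ) y) *
        f (Fin.cons y₀ y : Fin (n + 1) → ℝ) else 0 := by
  rw [volume_pi, lintegral_fin_succ_pi _ (f := fun y =>
    ENNReal.ofReal (density α A D y) * f y) ((measurable_density α A D).ennreal_ofReal.mul hf)]
  refine lintegral_congr fun y₀ => ?_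
  simp only [density_cons]
  split_ifs
  · rfl
  · simp

theorem stepVec_nonneg {ι κ : Type*} [Fintype ι] [DecidableEq ι] {A : Matrix ι ι ℝ}
    (hoff : ∀ i j, i ≠ j → 0 ≤ A i j) {D : Matrix ι κ ℝ} (hD : ∀ i j, 0 ≤ D i j) {v : ι → ℝ}
    (hv : ∀ i, 0 ≤ v i) {t : ℝ} (ht : 0 ≤ t) (j : κ) :
    0 ≤ stepVec A D v t j :=
  Finset.sum_nonneg fun i _ => mul_nonneg
    (Finset.sum_nonneg fun k _ => mul_nonneg (hv k) (exp_nonneg hoff ht k i)) (hD i j)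

theorem monotone_lintegral_cons {n : ℕ} (θ : Measure (Fin n → ℝ)) {f : (Fin (n + 1) → ℝ) → ENNReal}
    (hf : Monotone f) : Monotone fun y₀ => ∫⁻ y, f (Fin.cons y₀ y : Fin (n + 1) → ℝ) ∂θ :=
  fun _ _ h => lintegral_mono fun _ => hf (cons_le_cons h le_rfl)

theorem lintegral_cons_le_one {n : ℕ} (θ : Measure (Fin n → ℝ)) [IsProbabilityMeasure θ]
    {f : (Fin (n + 1) → ℝ) → ENNReal} (hf : ∀ y, f y ≤ 1) (y₀ : ℝ) :
    ∫⁻ y, f (Fin.cons y₀ y : Fin (n + 1) → ℝ) ∂θ ≤ 1 :=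
  (lintegral_mono fun _ => hf _).trans (by simp)

/-- If every component is stochastically smaller than `θ`, whatever its initial vector, then the
multivariate phase-type law is stochastically smaller than the product law. -/
theorem lintegral_density_le (θ : Measure ℝ) [IsProbabilityMeasure θ] {n : ℕ} :
    ∀ {S : Fin (n + 1) → Type*} [∀ k, Fintype (S k)] [∀ k, DecidableEq (S k)] (α : S 0 → ℝ)
    (A : ∀ k : Fin n, Matrix (S k.castSucc) (S k.castSucc) ℝ)
    (D : ∀ k : Fin n, Matrix (S k.castSucc) (S k.succ) ℝ), (∀ i, 0 ≤ α i) →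
    (∀ k i j, i ≠ j → 0 ≤ A k i j) → (∀ k i j, 0 ≤ D k i j) →
    (∀ k (v : S k.castSucc → ℝ), (∀ i, 0 ≤ v i) → ∀ g : ℝ → ENNReal, Monotone g → (∀ x, g x ≤ 1) →
      ∫⁻ x, g x ∂halfLineMeasure (stepDensity (A k) (D k) v) ≤
        ENNReal.ofReal (v ⬝ᵥ 1) * ∫⁻ x, g x ∂θ) →
    ∀ {f : (Fin n → ℝ) → ENNReal}, Measurable f → Monotone f → (∀ y, f y ≤ 1) →
      ∫⁻ y, ENNReal.ofReal (density α A D y) * f y ≤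
        ENNReal.ofReal (α ⬝ᵥ 1) * ∫⁻ y, f y ∂(Measure.pi fun _ => θ) := by
  induction n with
  | zero =>
    intro S _ _ α A D _ _ _ _ f _ _ _
    -- With no components the space is a single point and the density is the mass of `α`.
    rw [volume_pi, Measure.pi_of_empty, Measure.pi_of_empty, lintegral_dirac, lintegral_dirac]
    simp [density, rowVec]
  | succ n ih =>
    intro S _ _ α A D hα hA hD hstep f hfm hf hf1
    rw [lintegral_cons_density α A D hfm, lintegral_fin_succ_pi θ hfm]
    set G : ℝ → ENNReal := fun y₀ =>
      ∫⁻ y, f (Fin.cons y₀ y : Fin (n + 1) → ℝ) ∂(Measure.pi fun _ => θ)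
    have hG : Monotone G := monotone_lintegral_cons _ hf
    -- The inductive bound on the inner integral carries the mass of `stepVec`, which is
    -- `stepDensity` by definition. What remains is the one-component comparison for the monotone
    -- function `G`.
    refine le_trans ?_ ((lintegral_halfLineMeasure
      (continuous_stepDensity (A 0) (D 0) α).measurable hG.measurable).ge.trans
      (hstep 0 α hα G hG (lintegral_cons_le_one _ hf1)))
    refine lintegral_mono fun y₀ => ?_
    dsimp only
    split_ifs with hy₀
    · exact ih (S := tailBlocks S) _ (fun k => A k.succ) (fun k => D k.succ)
        (stepVec_nonneg (hA 0) (hD 0) hα hy₀) (fun k => hA k.succ) (fun k => hD k.succ)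
        (fun k => hstep k.succ) (hfm.comp (measurable_cons.comp measurable_prodMk_left))
        (fun _ _ h => hf (cons_le_cons le_rfl h)) (fun _ => hf1 _)
    · exact zero_le

/-- If every component is stochastically larger than `θ`, whatever its initial vector, then the
multivariate phase-type law is stochastically larger than the product law. -/
theorem le_lintegral_density (θ : Measure ℝ) [IsProbabilityMeasure θ] {n : ℕ} :
    ∀ {S : Fin (n + 1) → Type*} [∀ k, Fintype (S k)] [∀ k, DecidableEq (S k)] (α : S 0 → ℝ)
    (A : ∀ k : Fin n, Matrix (S k.castSucc) (S k.castSucc) ℝ)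
    (D : ∀ k : Fin n, Matrix (S k.castSucc) (S k.succ) ℝ), (∀ i, 0 ≤ α i) →
    (∀ k i j, i ≠ j → 0 ≤ A k i j) → (∀ k i j, 0 ≤ D k i j) →
    (∀ k (v : S k.castSucc → ℝ), (∀ i, 0 ≤ v i) → ∀ g : ℝ → ENNReal, Monotone g → (∀ x, g x ≤ 1) →
      ENNReal.ofReal (v ⬝ᵥ 1) * ∫⁻ x, g x ∂θ ≤
      ∫⁻ x, g x ∂halfLineMeasure (stepDensity (A k) (D k) v)) →
    ∀ {f : (Fin n → ℝ) → ENNReal}, Measurable f → Monotone f → (∀ y, f y ≤ 1) →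
      ENNReal.ofReal (α ⬝ᵥ 1) * ∫⁻ y, f y ∂(Measure.pi fun _ => θ) ≤
      ∫⁻ y, ENNReal.ofReal (density α A D y) * f y := by
  induction n with
  | zero =>
    intro S _ _ α A D _ _ _ _ f _ _ _
    rw [volume_pi, Measure.pi_of_empty, Measure.pi_of_empty, lintegral_dirac, lintegral_dirac]
    simp [density, rowVec]
  | succ n ih =>
    intro S _ _ α A D hα hA hD hstep f hfm hf hf1
    rw [lintegral_cons_density α A D hfm, lintegral_fin_succ_pi θ hfm]
    set G : ℝ → ENNReal := fun y₀ =>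
      ∫⁻ y, f (Fin.cons y₀ y : Fin (n + 1) → ℝ) ∂(Measure.pi fun _ => θ)
    have hG : Monotone G := monotone_lintegral_cons _ hf
    refine ((hstep 0 α hα G hG (lintegral_cons_le_one _ hf1)).trans
      (lintegral_halfLineMeasure
      (continuous_stepDensity (A 0) (D 0) α).measurable hG.measurable).le).trans ?_
    refine lintegral_mono fun y₀ => ?_
    dsimp only
    split_ifs with hy₀
    · exact ih (S := tailBlocks S) _ (fun k => A k.succ) (fun k => D k.succ)
        (stepVec_nonneg (hA 0) (hD 0) hα hy₀) (fun k => hA k.succ) (fun k => hD k.succ)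
        (fun k => hstep k.succ) (hfm.comp (measurable_cons.comp measurable_prodMk_left))
        (fun _ _ h => hf (cons_le_cons le_rfl h)) (fun _ => hf1 _)
    · simp

/-! ### Arbitrary increasing sets -/

theorem measure_interior_of_isUpperSet {n : ℕ} {μ : Measure (Fin n → ℝ)} (hμ : μ ≪ volume)
    {Γ : Set (Fin n → ℝ)} (hΓ : IsUpperSet Γ) : μ Γ = μ (interior Γ) :=
  (measure_congr (hμ.ae_le (interior_ae_eq_of_null_frontier hΓ.null_frontier))).symm

/-- Laws with densities are stochastically ordered once the integrals of bounded measurable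
increasing functions are ordered. -/
theorem stochLE_of_lintegral_le {n : ℕ} {μ ν : Measure (Fin n → ℝ)} (hμ : μ ≪ volume)
    (hν : ν ≪ volume) (h : ∀ f : (Fin n → ℝ) → ENNReal, Measurable f → Monotone f →
      (∀ y, f y ≤ 1) → ∫⁻ y, f y ∂μ ≤ ∫⁻ y, f y ∂ν) : StochLE μ ν := by
  intro Γ hΓ
  -- An upper set need not be Borel, but its frontier is Lebesgue-null and its interior is again an
  -- upper set, whose indicator is an admissible test function.
  rw [measure_interior_of_isUpperSet hμ hΓ, measure_interior_of_isUpperSet hν hΓ]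
  have hm : MeasurableSet (interior Γ) := isOpen_interior.measurableSet
  have := h ((interior Γ).indicator 1) (measurable_one.indicator hm) (fun x y hxy => ?_)
    (fun y => Set.indicator_le_self' (fun _ _ => zero_le) y)
  · rwa [lintegral_indicator_one hm, lintegral_indicator_one hm] at this
  · by_cases hx : x ∈ interior Γ
    · rw [Set.indicator_of_mem hx, Set.indicator_of_mem (hΓ.interior hxy hx)]; exact le_rfl
    · rw [Set.indicator_of_notMem hx]; exact zero_le

/-! ### One component against the exponential and Erlang laws -/

section Step

variable {ι κ : Type*} [Fintype ι] [DecidableEq ι] [Fintype κ] {A : Matrix ι ι ℝ}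
  {D : Matrix ι κ ℝ}

/-- Replacing `D 1` by `-A 1` exhibits the density as minus the derivative of `v e^{tA} 1`. -/
theorem stepDensity_eq (hrow : A *ᵥ 1 + D *ᵥ 1 = 0) (v : ι → ℝ) (t : ℝ) :
    stepDensity A D v t = -(v ⬝ᵥ (NormedSpace.exp (t • A) *ᵥ (A *ᵥ 1))) := by
  rw [stepDensity, stepVec, ← Matrix.dotProduct_mulVec, ← Matrix.dotProduct_mulVec,
    eq_neg_of_add_eq_zero_left hrow, Matrix.mulVec_neg, dotProduct_neg, neg_neg]

theorem hasDerivAt_survival (hrow : A *ᵥ 1 + D *ᵥ 1 = 0) (v : ι → ℝ) (t : ℝ) :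
    HasDerivAt (fun u : ℝ => v ⬝ᵥ (NormedSpace.exp (u • A) *ᵥ 1)) (-stepDensity A D v t) t :=
  (hasDerivAt_dotProduct_exp A v 1 t).congr_deriv (by rw [stepDensity_eq hrow, neg_neg])

theorem stepDensity_nonneg (hoff : ∀ i j, i ≠ j → 0 ≤ A i j) (hD : ∀ i j, 0 ≤ D i j) {v : ι → ℝ}
    (hv : ∀ i, 0 ≤ v i) {t : ℝ} (ht : 0 ≤ t) : 0 ≤ stepDensity A D v t :=
  Finset.sum_nonneg fun j _ => mul_nonneg (stepVec_nonneg hoff hD hv ht j) zero_le_one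

omit [DecidableEq ι] in
theorem mulVec_one_nonpos (hrow : A *ᵥ 1 + D *ᵥ 1 = 0) (hD : ∀ i j, 0 ≤ D i j) (i : ι) :
    (A *ᵥ 1) i ≤ 0 := by
  rw [eq_neg_of_add_eq_zero_left hrow, Pi.neg_apply, neg_nonpos]
  exact Finset.sum_nonneg fun j _ => mul_nonneg (hD i j) zero_le_one

theorem survival_le (hoff : ∀ i j, i ≠ j → 0 ≤ A i j) (hD : ∀ i j, 0 ≤ D i j)
    (hrow : A *ᵥ 1 + D *ᵥ 1 = 0) {σ : ℝ} (hσ : 0 < σ) (hσA : σ ≤ -dominatingEigenvalue A) {p : ℕ}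
    (hp : Fintype.card ι ≤ p) {v : ι → ℝ} (hv : ∀ i, 0 ≤ v i) {t : ℝ} (ht : 0 ≤ t) :
    v ⬝ᵥ (NormedSpace.exp (t • A) *ᵥ 1) ≤ v ⬝ᵥ 1 * erlangTail p σ t := by
  rw [dotProduct, dotProduct, Finset.sum_mul]
  refine Finset.sum_le_sum fun i _ => ?_
  rw [Pi.one_apply, mul_one]
  exact mul_le_mul_of_nonneg_left ((exp_mulVec_one_le hoff (mulVec_one_nonpos hrow hD) hσ hσA ht
    i).trans (erlangTail_mono hp hσ.le ht)) (hv i)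

theorem le_survival (hoff : ∀ i j, i ≠ j → 0 ≤ A i j) {r : ℝ} (hr : ∀ i, (-(A *ᵥ 1)) i ≤ r)
    {v : ι → ℝ} (hv : ∀ i, 0 ≤ v i) {t : ℝ} (ht : 0 ≤ t) :
    v ⬝ᵥ 1 * erlangTail 1 r t ≤ v ⬝ᵥ (NormedSpace.exp (t • A) *ᵥ 1) := by
  rw [dotProduct, dotProduct, Finset.sum_mul]
  refine Finset.sum_le_sum fun i _ => ?_
  rw [Pi.one_apply, mul_one]
  refine mul_le_mul_of_nonneg_left ?_ (hv i)
  have := le_exp_mulVec hoff (σ := r) (h := 1) (fun i => by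
    have := hr i; rw [Pi.neg_apply] at this; rw [Pi.one_apply]; linarith) ht i
  simpa [erlangTail] using this

theorem tendsto_survival (hoff : ∀ i j, i ≠ j → 0 ≤ A i j) (hD : ∀ i j, 0 ≤ D i j)
    (hrow : A *ᵥ 1 + D *ᵥ 1 = 0) {σ : ℝ} (hσ : 0 < σ) (hσA : σ ≤ -dominatingEigenvalue A)
    {v : ι → ℝ} (hv : ∀ i, 0 ≤ v i) :
    Tendsto (fun t : ℝ => v ⬝ᵥ (NormedSpace.exp (t • A) *ᵥ 1)) atTop (𝓝 0) := by
  have h := (tendsto_erlangTail (Fintype.card ι) hσ).const_mul (v ⬝ᵥ 1)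
  rw [mul_zero] at h
  refine squeeze_zero' ?_ ?_ h
  · filter_upwards [eventually_ge_atTop 0] with t ht
    exact Finset.sum_nonneg fun i _ => mul_nonneg (hv i)
      (Finset.sum_nonneg fun j _ => mul_nonneg (exp_nonneg hoff ht i j) zero_le_one)
  · filter_upwards [eventually_ge_atTop 0] with t ht
    exact survival_le hoff hD hrow hσ hσA le_rfl hv ht

theorem lintegral_halfLineMeasure_const_mul {c : ℝ} (hc : 0 ≤ c) {f : ℝ → ℝ} (hf : Measurable f)
    {g : ℝ → ENNReal} (hg : Measurable g) :
    ∫⁻ x, g x ∂halfLineMeasure (fun x => c * f x) =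
      ENNReal.ofReal c * ∫⁻ x, g x ∂halfLineMeasure f := by
  rw [lintegral_halfLineMeasure (hf.const_mul c) hg, lintegral_halfLineMeasure hf hg,
    ← lintegral_const_mul]
  · refine lintegral_congr fun x => ?_
    rw [← mul_assoc, ← ENNReal.ofReal_mul hc, mul_ite, mul_zero]
  · exact (Measurable.ite measurableSet_Ici hf measurable_const).ennreal_ofReal.mul hg

theorem measurable_erlangDensity (m : ℕ) (σ : ℝ) : Measurable (erlangDensity m σ) := by
  unfold erlangDensity
  fun_prop

omit [DecidableEq ι] in
theorem dotProduct_one_nonneg {v : ι → ℝ} (hv : ∀ i, 0 ≤ v i) : 0 ≤ v ⬝ᵥ 1 :=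
  Finset.sum_nonneg fun i _ => mul_nonneg (hv i) zero_le_one

/-- A phase-type law is stochastically smaller than an Erlang law. -/
theorem lintegral_step_le (hoff : ∀ i j, i ≠ j → 0 ≤ A i j) (hD : ∀ i j, 0 ≤ D i j)
    (hrow : A *ᵥ 1 + D *ᵥ 1 = 0) {σ : ℝ} (hσ : 0 < σ) (hσA : σ ≤ -dominatingEigenvalue A) {m : ℕ}
    (hp : Fintype.card ι ≤ m + 1) {v : ι → ℝ} (hv : ∀ i, 0 ≤ v i) {g : ℝ → ENNReal}
    (hg : Monotone g) (hg1 : ∀ x, g x ≤ 1) :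
    ∫⁻ x, g x ∂halfLineMeasure (stepDensity A D v) ≤
      ENNReal.ofReal (v ⬝ᵥ 1) * ∫⁻ x, g x ∂halfLineMeasure (erlangDensity m σ) := by
  have hv1 := dotProduct_one_nonneg hv
  rw [← lintegral_halfLineMeasure_const_mul hv1 (measurable_erlangDensity m σ) hg.measurable]
  refine lintegral_halfLineMeasure_le (F₂ := fun t => v ⬝ᵥ 1 * erlangTail (m + 1) σ t)
    (hasDerivAt_survival hrow v)
    (fun x => ((hasDerivAt_erlangTail m σ x).const_mul _).congr_deriv (by ring))
    (fun x hx => stepDensity_nonneg hoff hD hv hx)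
    (fun x hx => mul_nonneg hv1 (erlangDensity_nonneg m hσ hx))
    (tendsto_survival hoff hD hrow hσ hσA hv)
    (by simpa using (tendsto_erlangTail (m + 1) hσ).const_mul (v ⬝ᵥ 1))
    (fun x hx => survival_le hoff hD hrow hσ hσA hp hv hx) hg hg1

/-- A phase-type law is stochastically larger than an exponential law. -/
theorem le_lintegral_step (hoff : ∀ i j, i ≠ j → 0 ≤ A i j) (hD : ∀ i j, 0 ≤ D i j)
    (hrow : A *ᵥ 1 + D *ᵥ 1 = 0) {σ : ℝ} (hσ : 0 < σ) (hσA : σ ≤ -dominatingEigenvalue A) {r : ℝ}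
    (hr0 : 0 < r) (hr : ∀ i, (-(A *ᵥ 1)) i ≤ r) {v : ι → ℝ} (hv : ∀ i, 0 ≤ v i)
    {g : ℝ → ENNReal} (hg : Monotone g) (hg1 : ∀ x, g x ≤ 1) :
    ENNReal.ofReal (v ⬝ᵥ 1) * ∫⁻ x, g x ∂halfLineMeasure (erlangDensity 0 r) ≤
      ∫⁻ x, g x ∂halfLineMeasure (stepDensity A D v) := by
  have hv1 := dotProduct_one_nonneg hv
  rw [← lintegral_halfLineMeasure_const_mul hv1 (measurable_erlangDensity 0 r) hg.measurable]
  refine lintegral_halfLineMeasure_le (F₁ := fun t => v ⬝ᵥ 1 * erlangTail 1 r t)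
    (fun x => ((hasDerivAt_erlangTail 0 r x).const_mul _).congr_deriv (by ring))
    (hasDerivAt_survival hrow v)
    (fun x hx => mul_nonneg hv1 (erlangDensity_nonneg 0 hr0 hx))
    (fun x hx => stepDensity_nonneg hoff hD hv hx)
    (by simpa using (tendsto_erlangTail 1 hr0).const_mul (v ⬝ᵥ 1))
    (tendsto_survival hoff hD hrow hσ hσA hv)
    (fun x hx => le_survival hoff hr hv hx) hg hg1

omit [Fintype κ] in
/-- The exit rates of a block all of whose eigenvalues have negative real part do not all vanish. -/
theorem exists_exitRate_pos [Nonempty ι] (hoff : ∀ i j, i ≠ j → 0 ≤ A i j) {σ : ℝ} (hσ : 0 < σ)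
    (hσA : σ ≤ -dominatingEigenvalue A) : ∃ i, 0 < (-(A *ᵥ 1)) i := by
  by_contra! hle
  obtain ⟨h, hh, hA⟩ := exists_pos_of_lt_neg_dominatingEigenvalue hoff
    ((half_lt_self hσ).trans_le hσA)
  -- If no exit rate were positive, the minimum principle would apply to the constant vector `-1`.
  have := nonneg_of_mulVec_nonpos hoff hh
    (fun i => (hA i).trans_lt (by nlinarith [hh i])) (x := -1)
    (fun i => Or.inr (by rw [Matrix.mulVec_neg]; exact hle i)) (Classical.arbitrary ι)
  simp only [Pi.neg_apply, Pi.one_apply] at this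
  linarith

end Step

theorem absolutelyContinuous_pi_halfLineMeasure {f : ℝ → ℝ}
    [SigmaFinite (halfLineMeasure f)] (n : ℕ) :
    (Measure.pi fun _ : Fin n => halfLineMeasure f) ≪ volume := by
  induction n with
  | zero => rw [volume_pi, Measure.pi_of_empty, Measure.pi_of_empty]
  | succ n ih =>
    have h1 := measurePreserving_piFinSuccAbove (fun _ : Fin (n + 1) => halfLineMeasure f) 0
    have h2 := volume_preserving_piFinSuccAbove (fun _ : Fin (n + 1) => ℝ) 0
    have h3 := (halfLineMeasure_absolutelyContinuous f).prod ih
    rw [← h1.symm.map_eq, ← h2.symm.map_eq]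
    exact h3.map (MeasurableEquiv.measurable _)

end MultPH

/-! ### Comparison of the joint laws -/

theorem mainTheorem7 {n : ℕ} (hn : 1 ≤ n) {S : Fin (n + 1) → Type*}
    [∀ k, Fintype (S k)] [∀ k, DecidableEq (S k)]
    (α : S 0 → ℝ) (A : ∀ k : Fin n, Matrix (S k.castSucc) (S k.castSucc) ℝ)
    (D : ∀ k : Fin n, Matrix (S k.castSucc) (S k.succ) ℝ)
    (hrep : MultPH.IsRepresentation α A D)
    (ν : ℝ) (hν : MultPH.maxExitRate A ≤ ν)
    (p : ℕ) (hp : MultPH.maxDim S ≤ p)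
    (σ : ℝ) (hσ : 0 < σ) (hσn : σ ≤ -MultPH.maxDominatingEigenvalue A)
    {ΩY ΩL ΩH : Type*} [MeasurableSpace ΩY] [MeasurableSpace ΩL] [MeasurableSpace ΩH]
    (PY : Measure ΩY) (PL : Measure ΩL) (PH : Measure ΩH)
    [IsProbabilityMeasure PY] [IsProbabilityMeasure PL] [IsProbabilityMeasure PH]
    (Y : ΩY → Fin n → ℝ) (L : ΩL → Fin n → ℝ) (H : ΩH → Fin n → ℝ)
    (hY : HasLaw Y (MultPH.law α A D) PY)
    (hLlaw : ∀ k, HasLaw (fun ω => L ω k) (expMeasure ν) PL)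
    (hLindep : iIndepFun (fun k ω => L ω k) PL)
    (hHlaw : ∀ k, HasLaw (fun ω => H ω k) (MultPH.erlangMeasure p σ) PH)
    (hHindep : iIndepFun (fun k ω => H ω k) PH) :
    MultPH.StochLE (PL.map L) (PY.map Y) ∧ MultPH.StochLE (PY.map Y) (PH.map H) := by
  obtain ⟨n, rfl⟩ : ∃ m, n = m + 1 := ⟨n - 1, by omega⟩
  have hα1 : α ⬝ᵥ 1 = 1 := by simpa [dotProduct] using hrep.alpha_sum
  have hσk : ∀ k, σ ≤ -MultPH.dominatingEigenvalue (A k) := fun k => by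
    have : MultPH.dominatingEigenvalue (A k) ≤ MultPH.maxDominatingEigenvalue A :=
      le_ciSup (f := fun k => MultPH.dominatingEigenvalue (A k)) (Set.finite_range _).bddAbove k
    linarith
  have hpk : ∀ k : Fin (n + 1), Fintype.card (S k.castSucc) ≤ p := fun k =>
    (Finset.le_sup (f := fun k : Fin (n + 1) => Fintype.card (S k.castSucc))
      (Finset.mem_univ k)).trans hp
  have hνk : ∀ k i, (-(A k *ᵥ 1)) i ≤ ν := fun k i =>
    (le_ciSup (f := fun ki : (k : Fin (n + 1)) × S k.castSucc => (-(A ki.1 *ᵥ 1)) ki.2)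
      (Set.finite_range _).bddAbove ⟨k, i⟩).trans hν
  -- A probability vector needs a state. This forces `ν > 0` and `p ≥ 1`, so both comparison laws
  -- are probability measures and `p` can be written `m + 1`.
  have hne : Nonempty (S (0 : Fin (n + 1)).castSucc) := by
    by_contra h
    rw [not_nonempty_iff] at h
    exact one_ne_zero
      (hrep.alpha_sum.symm.trans (Finset.sum_eq_zero fun i _ => (h.false i).elim))
  have hν0 : 0 < ν := by
    obtain ⟨i, hi⟩ := MultPH.exists_exitRate_pos (hrep.offDiag_nonneg 0) hσ (hσk 0)
    exact hi.trans_le (hνk 0 i)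
  obtain ⟨m, rfl⟩ : ∃ m, p = m + 1 :=
    ⟨p - 1, by have := (Fintype.card_pos (α := S (0 : Fin (n + 1)).castSucc)).trans_le (hpk 0); omega⟩
  have hLm : ∀ k, AEMeasurable (fun ω => L ω k) PL := fun k => (hLlaw k).aemeasurable
  have hHm : ∀ k, AEMeasurable (fun ω => H ω k) PH := fun k => (hHlaw k).aemeasurable
  have heL : expMeasure ν = MultPH.halfLineMeasure (MultPH.erlangDensity 0 ν) := by
    rw [← MultPH.gammaMeasure_eq_halfLineMeasure, zero_add, Nat.cast_one]; rfl
  have heH : MultPH.erlangMeasure (m + 1) σ =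
      MultPH.halfLineMeasure (MultPH.erlangDensity m σ) :=
    MultPH.gammaMeasure_eq_halfLineMeasure m σ
  have : IsProbabilityMeasure (MultPH.halfLineMeasure (MultPH.erlangDensity 0 ν)) := by
    rw [← heL]; exact isProbabilityMeasure_expMeasure hν0
  have : IsProbabilityMeasure (MultPH.halfLineMeasure (MultPH.erlangDensity m σ)) := by
    rw [← heH]; exact isProbabilityMeasure_gammaMeasure (by positivity) hσ
  have hL : PL.map L = Measure.pi fun _ => MultPH.halfLineMeasure (MultPH.erlangDensity 0 ν) := by
    refine ((iIndepFun_iff_map_fun_eq_pi_map hLm).1 hLindep).trans ?_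
    simp only [fun k => (hLlaw k).map_eq, heL]
  have hH : PH.map H = Measure.pi fun _ => MultPH.halfLineMeasure (MultPH.erlangDensity m σ) := by
    refine ((iIndepFun_iff_map_fun_eq_pi_map hHm).1 hHindep).trans ?_
    simp only [fun k => (hHlaw k).map_eq, heH]
  have hlaw : ∀ f : (Fin (n + 1) → ℝ) → ENNReal, Measurable f → ∫⁻ y, f y ∂MultPH.law α A D =
      ∫⁻ y, ENNReal.ofReal (MultPH.density α A D y) * f y := fun f hf =>
    lintegral_withDensity_eq_lintegral_mul _ (MultPH.measurable_density α A D).ennreal_ofReal hf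
  have hlawac : MultPH.law α A D ≪ volume := withDensity_absolutelyContinuous _ _
  rw [hY.map_eq, hL, hH]
  constructor
  · refine MultPH.stochLE_of_lintegral_le (MultPH.absolutelyContinuous_pi_halfLineMeasure _)
      hlawac fun f hfm hf hf1 => ?_
    have := MultPH.le_lintegral_density (MultPH.halfLineMeasure (MultPH.erlangDensity 0 ν)) α A D
      hrep.alpha_nonneg hrep.offDiag_nonneg hrep.D_nonneg
      (fun k v hv g hg hg1 => MultPH.le_lintegral_step (hrep.offDiag_nonneg k) (hrep.D_nonneg k)
        (hrep.row_sum k) hσ (hσk k) hν0 (hνk k) hv hg hg1) hfm hf hf1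
    rwa [hα1, ENNReal.ofReal_one, one_mul, ← hlaw f hfm] at this
  · refine MultPH.stochLE_of_lintegral_le hlawac
      (MultPH.absolutelyContinuous_pi_halfLineMeasure _) fun f hfm hf hf1 => ?_
    have := MultPH.lintegral_density_le (MultPH.halfLineMeasure (MultPH.erlangDensity m σ)) α A D
      hrep.alpha_nonneg hrep.offDiag_nonneg hrep.D_nonneg
      (fun k v hv g hg hg1 => MultPH.lintegral_step_le (hrep.offDiag_nonneg k) (hrep.D_nonneg k)
        (hrep.row_sum k) hσ (hσk k) (hpk k) hv hg hg1) hfm hf hf1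
    rwa [hα1, ENNReal.ofReal_one, one_mul, ← hlaw f hfm] at this
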